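/- Let $D\subset\mathbb R^d$ be a bounded open set, let $A_1,\dots,A_n$ be pairwise disjoint sets with $\bigcup_{j=1}^n A_j=\{1,\dots,k\}$, and let $\Lambda_1,\dots,\Lambda_n>0$. Let $$H^1(D,\Sigma)=\{W=(w_1,\dots,w_k)\in H^1(D,\mathbb R^k):\ w_iw_{i'}=0 \text{ a.e. in } D \text{ if } i\in A_j,\ i'\in A_{j'},\ j\ne j'\}.$$ For $W\in H^1(D,\mathbb R^k)$ let $W_j$ be obtained from $W$ by replacing the components $w_i$ with $i\notin A_j$ by $0$, let $\Omega_{W_j}=\bigcup_{i\in A_j}\{x\in D: w_i(x)\neq0\}$ (defined up to null sets), and let $$J_\Lambda(W,D)=\int_D|\nabla W|^2\,dx+\sum_{j=1}^n\Lambda_j|\Omega_{W_j}|.$$ For every $g\in H^1(D,\Sigma)$ there is a minimizer $U$ of $J_\Lambda(\cdot,D)$ over the class $\{W\in H^1(D,\Sigma): W-g\in H^1_0(D,\mathbb R^k)\}$. Moreover, every such minimizer $U=(u_1,\dots,u_k)$ has the following properties. (i) For every $j$ and every $i\in A_j$, $u_i$ is (weakly) harmonic on $\Omega_{U_j}$,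 that is, $\int_D\nabla u_i\cdot\nabla v\,dx=0$ for all $v\in H^1_0(D)$ with $v=0$ a.e. on $D\setminus\Omega_{U_j}$. (ii) $|U|$ and, for every $j$, $|U_j|$ are subharmonic on $D$ in the sense of distributions, that is, $|U|,|U_j|\in L^1_{\rm loc}(D)$, and $\int_D|U|\,\Delta\varphi\,dx\ge0$ and $\int_D|U_j|\,\Delta\varphi\,dx\ge0$ for all $\varphi\in C_c^\infty(D)$ with $\varphi\ge0$. -/

import Mathlib

open MeasureTheory TopologicalSpace
open scoped ENNReal Gradient Laplacian

noncomputable section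

namespace MultiphaseBernoulli

/-- `G` is a weak gradient of `u` on the open set `D`: both are locally integrable on `D` and
`∫_D u ∂_v φ = - ∫_D ⟨G, v⟩ φ` for every direction `v` and every `φ ∈ C_c^∞(D)`. -/
def HasWeakGradient {d : ℕ} (D : Opens (EuclideanSpace ℝ (Fin d)))
    (u : EuclideanSpace ℝ (Fin d) → ℝ)
    (G : EuclideanSpace ℝ (Fin d) → EuclideanSpace ℝ (Fin d)) : Prop :=
  LocallyIntegrableOn u D volume ∧ LocallyIntegrableOn G D volume ∧
    ∀ (φ : TestFunction D ℝ ⊤) (v : EuclideanSpace ℝ (Fin d)),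
      ∫ x in D, u x * fderiv ℝ φ x v = - ∫ x in D, inner ℝ (G x) v * φ x

open Classical in
/-- The weak gradient of `u` on `D` (unique up to a null subset of `D` whenever it exists;
the value is `0` if there is none). -/
def weakGradient {d : ℕ} (D : Opens (EuclideanSpace ℝ (Fin d)))
    (u : EuclideanSpace ℝ (Fin d) → ℝ) : EuclideanSpace ℝ (Fin d) → EuclideanSpace ℝ (Fin d) :=
  if h : ∃ G, HasWeakGradient D u G then h.choose else 0

/-- `u ∈ H¹(D)`. -/
def MemH1 {d : ℕ} (D : Opens (EuclideanSpace ℝ (Fin d)))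
    (u : EuclideanSpace ℝ (Fin d) → ℝ) : Prop :=
  MemLp u 2 (volume.restrict D) ∧
    ∃ G, MemLp G 2 (volume.restrict D) ∧ HasWeakGradient D u G

/-- `u ∈ H¹₀(D)`, the closure of `C_c^∞(D)` in `H¹(D)`. -/
def MemH10 {d : ℕ} (D : Opens (EuclideanSpace ℝ (Fin d)))
    (u : EuclideanSpace ℝ (Fin d) → ℝ) : Prop :=
  MemH1 D u ∧ ∀ ε : ℝ≥0∞, 0 < ε → ∃ φ : TestFunction D ℝ ⊤,
    eLpNorm (fun x => u x - φ x) 2 (volume.restrict D) < ε ∧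
    eLpNorm (fun x => weakGradient D u x - ∇ φ x) 2 (volume.restrict D) < ε

/-- `v ∈ H¹₀(Ω)` for a measurable subset `Ω` of `D` that is only defined up to null sets and need
not be open: `v ∈ H¹₀(D)` and `v = 0` almost everywhere on `D \ Ω`. -/
def MemH10Of {d : ℕ} (D : Opens (EuclideanSpace ℝ (Fin d)))
    (Ω : Set (EuclideanSpace ℝ (Fin d))) (v : EuclideanSpace ℝ (Fin d) → ℝ) : Prop :=
  MemH10 D v ∧ ∀ᵐ x ∂(volume.restrict (D : Set (EuclideanSpace ℝ (Fin d)))), x ∉ Ω → v x = 0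

/-- `u ∈ H¹(D)` is harmonic on `Ω ⊆ D`: `∫_D ∇u · ∇v = 0` for all `v ∈ H¹₀(Ω)`. -/
def IsHarmonicOn {d : ℕ} (D : Opens (EuclideanSpace ℝ (Fin d)))
    (Ω : Set (EuclideanSpace ℝ (Fin d))) (u : EuclideanSpace ℝ (Fin d) → ℝ) : Prop :=
  MemH1 D u ∧ ∀ v, MemH10Of D Ω v →
    ∫ x in D, inner ℝ (weakGradient D u x) (weakGradient D v x) = 0

/-- `f` is subharmonic on `D` in the sense of distributions: `f ∈ L¹_loc(D)` and
`∫_D f Δφ ≥ 0` for all nonnegative `φ ∈ C_c^∞(D)`. -/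
def IsDistribSubharmonic {d : ℕ} (D : Opens (EuclideanSpace ℝ (Fin d)))
    (f : EuclideanSpace ℝ (Fin d) → ℝ) : Prop :=
  LocallyIntegrableOn f D volume ∧
    ∀ φ : TestFunction D ℝ ⊤, (∀ x, 0 ≤ φ x) →
      0 ≤ ∫ x in D, f x * Δ (φ : EuclideanSpace ℝ (Fin d) → ℝ) x

/-- `W ∈ H¹(D, Σ)`: all components are in `H¹(D)`, and `w_i w_{i'} = 0` a.e. in `D` whenever
`i`, `i'` belong to different groups `A_j`, `A_{j'}`. -/
def MemH1Sigma {d k n : ℕ} (D : Opens (EuclideanSpace ℝ (Fin d))) (A : Fin n → Finset (Fin k))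
    (W : EuclideanSpace ℝ (Fin d) → EuclideanSpace ℝ (Fin k)) : Prop :=
  (∀ i, MemH1 D (fun x => W x i)) ∧
    ∀ᵐ x ∂(volume.restrict (D : Set (EuclideanSpace ℝ (Fin d)))),
      ∀ j j', j ≠ j' → ∀ i ∈ A j, ∀ i' ∈ A j', W x i * W x i' = 0

/-- `W_j`: the components in `A_j` are kept, the others are replaced by `0`. -/
def group {d k n : ℕ} (A : Fin n → Finset (Fin k))
    (W : EuclideanSpace ℝ (Fin d) → EuclideanSpace ℝ (Fin k)) (j : Fin n) :
    EuclideanSpace ℝ (Fin d) → EuclideanSpace ℝ (Fin k) :=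
  fun x => WithLp.toLp 2 (fun i => if i ∈ A j then W x i else 0)

/-- The phase `Ω_{W_j}`: the points of `D` at which some `w_i` with `i ∈ A_j` does not vanish. -/
def phase {d k n : ℕ} (D : Opens (EuclideanSpace ℝ (Fin d))) (A : Fin n → Finset (Fin k))
    (W : EuclideanSpace ℝ (Fin d) → EuclideanSpace ℝ (Fin k)) (j : Fin n) :
    Set (EuclideanSpace ℝ (Fin d)) :=
  {x | x ∈ D ∧ ∃ i ∈ A j, W x i ≠ 0}

/-- The functional `J_Λ(W, D) = ∫_D |∇W|² + ∑_j Λ_j |Ω_{W_j}|`. -/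
def energy {d k n : ℕ} (D : Opens (EuclideanSpace ℝ (Fin d))) (A : Fin n → Finset (Fin k))
    (Λ : Fin n → ℝ) (W : EuclideanSpace ℝ (Fin d) → EuclideanSpace ℝ (Fin k)) : ℝ :=
  (∫ x in D, ∑ i, ‖weakGradient D (fun y => W y i) x‖ ^ 2) +
    ∑ j, Λ j * volume.real (phase D A W j)

/-- `W` competes for the boundary datum `g`: `W ∈ H¹(D, Σ)` and `W - g ∈ H¹₀(D, ℝ^k)`. -/
def IsAdmissible {d k n : ℕ} (D : Opens (EuclideanSpace ℝ (Fin d))) (A : Fin n → Finset (Fin k))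
    (g W : EuclideanSpace ℝ (Fin d) → EuclideanSpace ℝ (Fin k)) : Prop :=
  MemH1Sigma D A W ∧ ∀ i, MemH10 D (fun x => W x i - g x i)

/-- `U` minimizes `J_Λ(·, D)` among all competitors for the boundary datum `g`. -/
def IsMinimizer {d k n : ℕ} (D : Opens (EuclideanSpace ℝ (Fin d))) (A : Fin n → Finset (Fin k))
    (Λ : Fin n → ℝ) (g U : EuclideanSpace ℝ (Fin d) → EuclideanSpace ℝ (Fin k)) : Prop :=
  IsAdmissible D A g U ∧ ∀ W, IsAdmissible D A g W → energy D A Λ U ≤ energy D A Λ W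

end MultiphaseBernoulli

end

/-! Existence of minimizers is the direct method. Along a minimizing sequence the gradients of
`W - g` are bounded in `L²`, so by weak compactness, the Poincaré inequality and Rellich's theorem a
subsequence converges almost everywhere, with weakly convergent gradients, and the limit still
differs from `g` by an `H¹₀` function (`exists_subseq_hasH10Grad`). Almost everywhere convergence
preserves the constraint `w_i w_{i'} = 0` and makes the measures of the phases lower semicontinuous,
since a point of a phase of the limit eventually belongs to the phases of the sequence; the
Dirichlet integral is weakly lower semicontinuous (`energy_le_of_tendsto`). Poincaré and Rellich
both come from `‖φ(· - t) - φ‖ ≤ ‖t‖ ‖∇φ‖`: take `t` longer than the diameter of `D` for the first,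
and average over small `t`, that is, mollify, for the second.

A minimizer `U` is harmonic on its phases because `U + t v e_i`, with `i ∈ A_j` and `v` vanishing
outside `Ω_{U_j}`, is a competitor none of whose phases is larger, so that
`t ↦ 2 t ∫ ∇u_i · ∇v + t² ∫ |∇v|²` is nonnegative (`IsMinimizer.isHarmonicOn`).

For the subharmonicity of `|U_j|` put `N_ε = √(|U_j|² + ε²)`. Testing the harmonicity of `u_i`
with `φ u_i / N_ε`, which vanishes outside `Ω_{U_j}`, and summing over `i ∈ A_j` gives
`∫ ∇N_ε · ∇φ = - ∫ φ (N_ε² |∇U_j|² - |∑_i u_i ∇u_i|²) / N_ε³ ≤ 0` by the Cauchy-Schwarz inequality,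
and `ε → 0` yields the claim (`isDistribSubharmonic_sqrt`). At almost every point at most one of
the `U_j` does not vanish, whence `|U| = ∑_j |U_j|` is subharmonic as well. These test functions
are admissible by the chain rule for `C¹` functions with bounded derivatives of several `H¹`
functions (`HasH1Grad.comp`), and because the product of an `H¹` function and a test function lies
in `H¹₀` (`HasH1Grad.mul_testFunction`).
-/

namespace MultiphaseBernoulli

open Filter Set Topology

/-! ### Square-integrable functions -/

section L2

variable {α F : Type*} [MeasurableSpace α] [NormedAddCommGroup F] [InnerProductSpace ℝ F]
  {μ : Measure α} {f g : α → F}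

lemma integrable_inner_of_memLp (hf : MemLp f 2 μ) (hg : MemLp g 2 μ) :
    Integrable (fun x => inner ℝ (f x) (g x)) μ := by
  refine (L2.integrable_inner (𝕜 := ℝ) hf.toLp hg.toLp).congr ?_
  filter_upwards [hf.coeFn_toLp, hg.coeFn_toLp] with x h1 h2
  rw [h1, h2]

lemma inner_toLp (hf : MemLp f 2 μ) (hg : MemLp g 2 μ) :
    inner ℝ hf.toLp hg.toLp = ∫ x, inner ℝ (f x) (g x) ∂μ := by
  rw [L2.inner_def]
  refine integral_congr_ae ?_
  filter_upwards [hf.coeFn_toLp, hg.coeFn_toLp] with x h1 h2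
  rw [h1, h2]

lemma abs_integral_inner_le (hf : MemLp f 2 μ) (hg : MemLp g 2 μ) :
    |∫ x, inner ℝ (f x) (g x) ∂μ| ≤ (eLpNorm f 2 μ).toReal * (eLpNorm g 2 μ).toReal := by
  rw [← inner_toLp hf hg, ← Lp.norm_toLp f hf, ← Lp.norm_toLp g hg]
  exact abs_real_inner_le_norm _ _

lemma integral_norm_sq_eq (hf : MemLp f 2 μ) :
    ∫ x, ‖f x‖ ^ 2 ∂μ = (eLpNorm f 2 μ).toReal ^ 2 := by
  rw [← Lp.norm_toLp f hf, ← real_inner_self_eq_norm_sq, inner_toLp]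
  simp

lemma tendsto_integral_inner {ι : Type*} {l : Filter ι} {f : ι → α → F} {f₀ h : α → F}
    (hf : ∀ i, MemLp (f i) 2 μ) (hf₀ : MemLp f₀ 2 μ) (hh : MemLp h 2 μ)
    (hlim : Tendsto (fun i => eLpNorm (fun x => f₀ x - f i x) 2 μ) l (𝓝 0)) :
    Tendsto (fun i => ∫ x, inner ℝ (f i x) (h x) ∂μ) l (𝓝 (∫ x, inner ℝ (f₀ x) (h x) ∂μ)) := by
  rw [tendsto_iff_dist_tendsto_zero]
  have h0 : Tendsto (fun i => (eLpNorm (fun x => f₀ x - f i x) 2 μ).toReal *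
      (eLpNorm h 2 μ).toReal) l (𝓝 0) := by
    simpa using ((ENNReal.tendsto_toReal ENNReal.zero_ne_top).comp hlim).mul_const
      (eLpNorm h 2 μ).toReal
  refine squeeze_zero (fun _ => dist_nonneg) (fun i => ?_) h0
  rw [dist_comm, Real.dist_eq, ← integral_sub (integrable_inner_of_memLp hf₀ hh)
    (integrable_inner_of_memLp (hf i) hh)]
  simp_rw [← inner_sub_left]
  exact abs_integral_inner_le (hf₀.sub (hf i)) hh

lemma tendsto_integral_mul {ι : Type*} {l : Filter ι} {f : ι → α → ℝ} {f₀ h : α → ℝ}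
    (hf : ∀ i, MemLp (f i) 2 μ) (hf₀ : MemLp f₀ 2 μ) (hh : MemLp h 2 μ)
    (hlim : Tendsto (fun i => eLpNorm (fun x => f₀ x - f i x) 2 μ) l (𝓝 0)) :
    Tendsto (fun i => ∫ x, f i x * h x ∂μ) l (𝓝 (∫ x, f₀ x * h x ∂μ)) := by
  simpa [mul_comm] using tendsto_integral_inner hf hf₀ hh hlim

end L2

/-! ### Weak gradients -/

section WeakGradient

variable {d : ℕ} {D : Opens (EuclideanSpace ℝ (Fin d))} {u v : EuclideanSpace ℝ (Fin d) → ℝ}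
  {G H : EuclideanSpace ℝ (Fin d) → EuclideanSpace ℝ (Fin d)}

lemma gradient_eq_toDual_symm (f : EuclideanSpace ℝ (Fin d) → ℝ) :
    ∇ f = (InnerProductSpace.toDual ℝ _).symm ∘ fderiv ℝ f := rfl

lemma continuous_gradient {f : EuclideanSpace ℝ (Fin d) → ℝ} (hf : ContDiff ℝ 1 f) :
    Continuous (∇ f) := by
  rw [gradient_eq_toDual_symm]
  exact (LinearIsometryEquiv.continuous _).comp (hf.continuous_fderiv one_ne_zero)

lemma hasCompactSupport_gradient {f : EuclideanSpace ℝ (Fin d) → ℝ} (hf : HasCompactSupport f) :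
    HasCompactSupport (∇ f) := by
  rw [gradient_eq_toDual_symm]
  exact (hf.fderiv ℝ).comp_left (map_zero _)

lemma norm_gradient (f : EuclideanSpace ℝ (Fin d) → ℝ) (x : EuclideanSpace ℝ (Fin d)) :
    ‖∇ f x‖ = ‖fderiv ℝ f x‖ := by
  rw [gradient_eq_toDual_symm]; simp

lemma _root_.TestFunction.contDiff_top (φ : TestFunction D ℝ ⊤) :
    ContDiff ℝ ((⊤ : ℕ∞) : WithTop ℕ∞) φ := φ.contDiff

lemma _root_.TestFunction.contDiff_one (φ : TestFunction D ℝ ⊤) : ContDiff ℝ 1 φ :=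
  φ.contDiff.of_le (by exact_mod_cast le_top)

lemma _root_.TestFunction.differentiable (φ : TestFunction D ℝ ⊤) : Differentiable ℝ φ :=
  (TestFunction.contDiff_one φ).differentiable one_ne_zero

lemma _root_.TestFunction.eq_zero_of_notMem (φ : TestFunction D ℝ ⊤) {x : EuclideanSpace ℝ (Fin d)}
    (hx : x ∉ D) : φ x = 0 :=
  image_eq_zero_of_notMem_tsupport fun h => hx (φ.tsupport_subset h)

lemma _root_.TestFunction.fderiv_eq_zero_of_notMem (φ : TestFunction D ℝ ⊤)
    {x : EuclideanSpace ℝ (Fin d)} (hx : x ∉ D) : fderiv ℝ φ x = 0 :=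
  image_eq_zero_of_notMem_tsupport fun h => hx (φ.tsupport_subset (tsupport_fderiv_subset ℝ h))

lemma _root_.TestFunction.gradient_eq_zero_of_notMem (φ : TestFunction D ℝ ⊤)
    {x : EuclideanSpace ℝ (Fin d)} (hx : x ∉ D) : ∇ φ x = 0 := by
  rw [gradient_eq_toDual_symm]
  simp [TestFunction.fderiv_eq_zero_of_notMem φ hx]

lemma _root_.TestFunction.continuous_fderiv_apply (φ : TestFunction D ℝ ⊤)
    (w : EuclideanSpace ℝ (Fin d)) : Continuous fun x => fderiv ℝ φ x w :=
  ((TestFunction.contDiff_one φ).continuous_fderiv one_ne_zero).clm_apply continuous_const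

lemma _root_.TestFunction.hasCompactSupport_fderiv_apply (φ : TestFunction D ℝ ⊤)
    (w : EuclideanSpace ℝ (Fin d)) : HasCompactSupport fun x => fderiv ℝ φ x w :=
  φ.hasCompactSupport.fderiv_apply ℝ w

lemma _root_.TestFunction.memLp (φ : TestFunction D ℝ ⊤) (p : ℝ≥0∞)
    (μ : Measure (EuclideanSpace ℝ (Fin d))) [IsFiniteMeasureOnCompacts μ] : MemLp φ p μ :=
  φ.continuous.memLp_of_hasCompactSupport φ.hasCompactSupport

lemma _root_.TestFunction.memLp_fderiv_apply (φ : TestFunction D ℝ ⊤) (w : EuclideanSpace ℝ (Fin d))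
    (p : ℝ≥0∞) (μ : Measure (EuclideanSpace ℝ (Fin d))) [IsFiniteMeasureOnCompacts μ] :
    MemLp (fun x => fderiv ℝ φ x w) p μ :=
  (TestFunction.continuous_fderiv_apply φ w).memLp_of_hasCompactSupport
    (TestFunction.hasCompactSupport_fderiv_apply φ w)

lemma _root_.TestFunction.memLp_gradient (φ : TestFunction D ℝ ⊤) (p : ℝ≥0∞)
    (μ : Measure (EuclideanSpace ℝ (Fin d))) [IsFiniteMeasureOnCompacts μ] : MemLp (∇ φ) p μ :=
  (continuous_gradient (TestFunction.contDiff_one φ)).memLp_of_hasCompactSupport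
    (hasCompactSupport_gradient φ.hasCompactSupport)

lemma _root_.TestFunction.gradient_add (φ ψ : TestFunction D ℝ ⊤) (x : EuclideanSpace ℝ (Fin d)) :
    ∇ (φ + ψ : TestFunction D ℝ ⊤) x = ∇ φ x + ∇ ψ x := by
  have : fderiv ℝ (φ + ψ : TestFunction D ℝ ⊤) x = fderiv ℝ φ x + fderiv ℝ ψ x :=
    fderiv_add (TestFunction.differentiable φ x) (TestFunction.differentiable ψ x)
  rw [gradient, this, map_add]
  rfl

lemma _root_.TestFunction.gradient_smul (c : ℝ) (φ : TestFunction D ℝ ⊤)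
    (x : EuclideanSpace ℝ (Fin d)) : ∇ (c • φ : TestFunction D ℝ ⊤) x = c • ∇ φ x := by
  have : fderiv ℝ (c • φ : TestFunction D ℝ ⊤) x = c • fderiv ℝ φ x :=
    fderiv_const_smul (TestFunction.differentiable φ x) c
  rw [gradient, this, map_smul]
  rfl

/-- The product of a test function on `D` and a smooth function, as a test function on `D`. -/
noncomputable def _root_.TestFunction.mulSmooth (φ : TestFunction D ℝ ⊤)
    (f : EuclideanSpace ℝ (Fin d) → ℝ) (hf : ContDiff ℝ ((⊤ : ℕ∞) : WithTop ℕ∞) f) :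
    TestFunction D ℝ ⊤ where
  toFun x := φ x * f x
  contDiff' := φ.contDiff.mul hf
  hasCompactSupport' := φ.hasCompactSupport.mul_right
  tsupport_subset' := (tsupport_mul_subset_left).trans φ.tsupport_subset

@[simp] lemma _root_.TestFunction.mulSmooth_apply (φ : TestFunction D ℝ ⊤)
    (f : EuclideanSpace ℝ (Fin d) → ℝ) (hf : ContDiff ℝ ((⊤ : ℕ∞) : WithTop ℕ∞) f)
    (x : EuclideanSpace ℝ (Fin d)) : TestFunction.mulSmooth φ f hf x = φ x * f x := rfl

/-- The directional derivative of a test function, as a test function. -/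
noncomputable def _root_.TestFunction.dirDeriv (φ : TestFunction D ℝ ⊤)
    (w : EuclideanSpace ℝ (Fin d)) : TestFunction D ℝ ⊤ where
  toFun x := fderiv ℝ φ x w
  contDiff' := (φ.contDiff.fderiv_right (m := ((⊤ : ℕ∞) : WithTop ℕ∞)) (by rfl)).clm_apply
    contDiff_const
  hasCompactSupport' := TestFunction.hasCompactSupport_fderiv_apply φ w
  tsupport_subset' := (tsupport_fderiv_apply_subset ℝ w).trans φ.tsupport_subset

lemma HasWeakGradient.congr (h : HasWeakGradient D u G)
    (hu : u =ᵐ[volume.restrict D] v) (hG : G =ᵐ[volume.restrict D] H) :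
    HasWeakGradient D v H := by
  refine ⟨?_, ?_, fun φ w => ?_⟩
  · intro x hx
    obtain ⟨t, ht, hi⟩ := h.1 x hx
    refine ⟨t ∩ D, inter_mem ht self_mem_nhdsWithin, ?_⟩
    exact (hi.mono_set inter_subset_left).congr_fun_ae
        (ae_restrict_of_ae_restrict_of_subset inter_subset_right hu)
  · intro x hx
    obtain ⟨t, ht, hi⟩ := h.2.1 x hx
    refine ⟨t ∩ D, inter_mem ht self_mem_nhdsWithin, ?_⟩
    exact (hi.mono_set inter_subset_left).congr_fun_ae
        (ae_restrict_of_ae_restrict_of_subset inter_subset_right hG)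
  · calc ∫ x in D, v x * fderiv ℝ φ x w = ∫ x in D, u x * fderiv ℝ φ x w :=
          integral_congr_ae (by filter_upwards [hu] with x hx; rw [hx])
      _ = - ∫ x in D, inner ℝ (G x) w * φ x := h.2.2 φ w
      _ = - ∫ x in D, inner ℝ (H x) w * φ x := by
          rw [neg_inj]
          exact integral_congr_ae (by filter_upwards [hG] with x hx; rw [hx])

/-- Weak gradients are unique up to null subsets of `D`. -/
lemma HasWeakGradient.ae_eq (h : HasWeakGradient D u G) (h' : HasWeakGradient D u H) :
    G =ᵐ[volume.restrict D] H := by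
  have key : ∀ᵐ x ∂(volume : Measure (EuclideanSpace ℝ (Fin d))), x ∈ (D : Set _) →
      (G - H) x = 0 := by
    refine D.isOpen.ae_eq_zero_of_integral_contDiff_smul_eq_zero (h.2.1.sub h'.2.1) ?_
    intro ψ hψ hc hs
    let φ : TestFunction D ℝ ⊤ := ⟨ψ, hψ, hc, hs⟩
    have hint : ∀ K : EuclideanSpace ℝ (Fin d) → EuclideanSpace ℝ (Fin d),
        LocallyIntegrableOn K D volume → Integrable (fun x => ψ x • K x) := by
      intro K hK
      have h1 : IntegrableOn (fun x => ψ x • K x) (tsupport ψ) :=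
        (hK.integrableOn_compact_subset hs hc).continuousOn_smul hψ.continuous.continuousOn hc
      have h2 : Function.support (fun x => ψ x • K x) ⊆ tsupport ψ :=
        (Function.support_smul_subset_left ψ K).trans (subset_tsupport ψ)
      exact (integrableOn_iff_integrable_of_support_subset h2).1 h1
    refine ext_inner_right ℝ fun w => ?_
    have e1 : ∀ K : EuclideanSpace ℝ (Fin d) → EuclideanSpace ℝ (Fin d),
        LocallyIntegrableOn K D volume →
        inner ℝ (∫ x, ψ x • K x) w = ∫ x in D, inner ℝ (K x) w * φ x := by
      intro K hK
      rw [setIntegral_eq_integral_of_forall_compl_eq_zero, real_inner_comm,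
        ← integral_inner (hint K hK)]
      · refine integral_congr_ae (Eventually.of_forall fun x => ?_)
        simp only [inner_smul_right, real_inner_comm w]
        exact mul_comm _ _
      · intro x hx
        rw [TestFunction.eq_zero_of_notMem φ hx, mul_zero]
    have e2 : ∫ x, ψ x • (G - H) x = (∫ x, ψ x • G x) - ∫ x, ψ x • H x := by
      rw [← integral_sub (hint G h.2.1) (hint H h'.2.1)]
      simp [smul_sub]
    rw [e2, inner_sub_left, e1 G h.2.1, e1 H h'.2.1, inner_zero_left]
    have := (h.2.2 φ w).symm.trans (h'.2.2 φ w)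
    linarith
  rw [EventuallyEq, ae_restrict_iff' D.isOpen.measurableSet]
  filter_upwards [key] with x hx hxD
  exact sub_eq_zero.1 (hx hxD)

lemma HasWeakGradient.weakGradient_ae_eq (h : HasWeakGradient D u G) :
    weakGradient D u =ᵐ[volume.restrict D] G := by
  have hex : ∃ G, HasWeakGradient D u G := ⟨G, h⟩
  have : weakGradient D u = hex.choose := by simp only [weakGradient, dif_pos hex]
  rw [this]
  exact hex.choose_spec.ae_eq h

/-- `u ∈ H¹(D)` and `G` is its weak gradient. Carrying the gradient as an argument avoids computing
`weakGradient`, which is only determined almost everywhere on `D`. -/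
structure HasH1Grad (D : Opens (EuclideanSpace ℝ (Fin d))) (u : EuclideanSpace ℝ (Fin d) → ℝ)
    (G : EuclideanSpace ℝ (Fin d) → EuclideanSpace ℝ (Fin d)) : Prop where
  memLp : MemLp u 2 (volume.restrict D)
  memLp_grad : MemLp G 2 (volume.restrict D)
  weak : HasWeakGradient D u G

lemma HasH1Grad.memH1 (h : HasH1Grad D u G) : MemH1 D u := ⟨h.memLp, G, h.memLp_grad, h.weak⟩

lemma HasH1Grad.weakGradient_ae_eq (h : HasH1Grad D u G) :
    weakGradient D u =ᵐ[volume.restrict D] G := h.weak.weakGradient_ae_eq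

lemma MemH1.hasH1Grad (h : MemH1 D u) : HasH1Grad D u (weakGradient D u) := by
  obtain ⟨hu, G, hG, hw⟩ := h
  have e := hw.weakGradient_ae_eq.symm
  exact ⟨hu, hG.ae_eq e, hw.congr (EventuallyEq.refl _ _) e⟩

lemma HasH1Grad.congr (h : HasH1Grad D u G)
    (hu : u =ᵐ[volume.restrict D] v) (hG : G =ᵐ[volume.restrict D] H) : HasH1Grad D v H :=
  ⟨h.memLp.ae_eq hu, h.memLp_grad.ae_eq hG, h.weak.congr hu hG⟩

lemma HasH1Grad.of_integral (hu : MemLp u 2 (volume.restrict D))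
    (hG : MemLp G 2 (volume.restrict D))
    (h : ∀ (φ : TestFunction D ℝ ⊤) (w : EuclideanSpace ℝ (Fin d)),
      ∫ x in D, u x * fderiv ℝ φ x w = - ∫ x in D, inner ℝ (G x) w * φ x) :
    HasH1Grad D u G :=
  ⟨hu, hG, locallyIntegrableOn_of_locallyIntegrable_restrict (hu.locallyIntegrable one_le_two),
    locallyIntegrableOn_of_locallyIntegrable_restrict (hG.locallyIntegrable one_le_two), h⟩

lemma integrable_mul_of_memLp {f g : EuclideanSpace ℝ (Fin d) → ℝ}
    {μ : Measure (EuclideanSpace ℝ (Fin d))} (hf : MemLp f 2 μ) (hg : MemLp g 2 μ) :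
    Integrable (fun x => f x * g x) μ := hf.integrable_mul hg

lemma memLp_inner_const {μ : Measure (EuclideanSpace ℝ (Fin d))} (hG : MemLp G 2 μ)
    (w : EuclideanSpace ℝ (Fin d)) : MemLp (fun x => inner ℝ (G x) w) 2 μ :=
  hG.inner_const w

lemma integral_inner_mul_eq (w : EuclideanSpace ℝ (Fin d)) (φ : EuclideanSpace ℝ (Fin d) → ℝ)
    (μ : Measure (EuclideanSpace ℝ (Fin d))) :
    ∫ x, inner ℝ (G x) w * φ x ∂μ = ∫ x, inner ℝ (G x) (φ x • w) ∂μ := by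
  simp [inner_smul_right, mul_comm]

lemma HasH1Grad.add (h : HasH1Grad D u G) (h' : HasH1Grad D v H) :
    HasH1Grad D (fun x => u x + v x) (fun x => G x + H x) := by
  refine .of_integral (h.memLp.add h'.memLp) (h.memLp_grad.add h'.memLp_grad) fun φ w => ?_
  have hd := TestFunction.memLp_fderiv_apply φ w 2 (volume.restrict D)
  have hφ := TestFunction.memLp φ 2 (volume.restrict D)
  simp only [add_mul, inner_add_left]
  rw [integral_add (integrable_mul_of_memLp h.memLp hd) (integrable_mul_of_memLp h'.memLp hd),
    integral_add (integrable_mul_of_memLp (memLp_inner_const h.memLp_grad w) hφ)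
    (integrable_mul_of_memLp (memLp_inner_const h'.memLp_grad w) hφ), h.weak.2.2 φ w,
    h'.weak.2.2 φ w]
  ring

lemma HasH1Grad.smul (c : ℝ) (h : HasH1Grad D u G) :
    HasH1Grad D (fun x => c * u x) (fun x => c • G x) := by
  refine .of_integral (h.memLp.const_mul c) (h.memLp_grad.const_smul c) fun φ w => ?_
  simp only [mul_assoc, real_inner_smul_left]
  rw [integral_const_mul, integral_const_mul, h.weak.2.2 φ w]
  ring

lemma HasH1Grad.sub (h : HasH1Grad D u G) (h' : HasH1Grad D v H) :
    HasH1Grad D (fun x => u x - v x) (fun x => G x - H x) := by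
  simpa [sub_eq_add_neg] using h.add (h'.smul (-1))

/-- Weak gradients pass to weak limits in `L²`. -/
lemma HasH1Grad.of_tendsto {ι : Type*} {l : Filter ι} [l.NeBot]
    {un : ι → EuclideanSpace ℝ (Fin d) → ℝ}
    {Gn : ι → EuclideanSpace ℝ (Fin d) → EuclideanSpace ℝ (Fin d)}
    (hn : ∀ i, HasH1Grad D (un i) (Gn i))
    (hu : MemLp u 2 (volume.restrict D)) (hG : MemLp G 2 (volume.restrict D))
    (hlu : ∀ h, MemLp h 2 (volume.restrict D) →
      Tendsto (fun i => ∫ x in D, un i x * h x) l (𝓝 (∫ x in D, u x * h x)))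
    (hlG : ∀ h, MemLp h 2 (volume.restrict D) →
      Tendsto (fun i => ∫ x in D, inner ℝ (Gn i x) (h x)) l (𝓝 (∫ x in D, inner ℝ (G x) (h x)))) :
    HasH1Grad D u G := by
  refine .of_integral hu hG fun φ w => ?_
  have h1 := hlu _ (TestFunction.memLp_fderiv_apply φ w 2 (volume.restrict D))
  have h2 := (hlG (fun x => φ x • w)
    ((φ.continuous.smul continuous_const).memLp_of_hasCompactSupport
      φ.hasCompactSupport.smul_right)).neg
  simp only [← integral_inner_mul_eq] at h2
  refine tendsto_nhds_unique h1 (h2.congr fun i => ?_)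
  exact ((hn i).weak.2.2 φ w).symm

lemma _root_.TestFunction.hasH1Grad (φ : TestFunction D ℝ ⊤) : HasH1Grad D φ (∇ φ) := by
  refine .of_integral (φ.memLp 2 _) (φ.memLp_gradient 2 _) fun ψ w => ?_
  simp only [inner_gradient_left]
  rw [setIntegral_eq_integral_of_forall_compl_eq_zero,
    setIntegral_eq_integral_of_forall_compl_eq_zero]
  · exact integral_mul_fderiv_eq_neg_fderiv_mul_of_integrable
      (integrable_mul_of_memLp (φ.memLp_fderiv_apply w 2 _) (ψ.memLp 2 _))
      (integrable_mul_of_memLp (φ.memLp 2 _) (ψ.memLp_fderiv_apply w 2 _))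
      (integrable_mul_of_memLp (φ.memLp 2 _) (ψ.memLp 2 _))
      (fun x _ => φ.differentiable x) (fun x _ => ψ.differentiable x)
  · intro x hx; rw [ψ.eq_zero_of_notMem hx, mul_zero]
  · intro x hx; rw [φ.eq_zero_of_notMem hx, zero_mul]

/-- `u ∈ H¹₀(D)` and `G` is its weak gradient; `MemH10` with the gradient as an argument. -/
def HasH10Grad (D : Opens (EuclideanSpace ℝ (Fin d))) (u : EuclideanSpace ℝ (Fin d) → ℝ)
    (G : EuclideanSpace ℝ (Fin d) → EuclideanSpace ℝ (Fin d)) : Prop :=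
  HasH1Grad D u G ∧ ∀ ε : ℝ≥0∞, 0 < ε → ∃ φ : TestFunction D ℝ ⊤,
    eLpNorm (fun x => u x - φ x) 2 (volume.restrict D) < ε ∧
    eLpNorm (fun x => G x - ∇ φ x) 2 (volume.restrict D) < ε

lemma HasH10Grad.memH10 (h : HasH10Grad D u G) : MemH10 D u := by
  refine ⟨h.1.memH1, fun ε hε => ?_⟩
  obtain ⟨φ, h1, h2⟩ := h.2 ε hε
  refine ⟨φ, h1, ?_⟩
  rwa [eLpNorm_congr_ae (g := fun x => G x - ∇ φ x)]
  filter_upwards [h.1.weakGradient_ae_eq] with x hx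
  rw [hx]

lemma MemH10.hasH10Grad (h : MemH10 D u) : HasH10Grad D u (weakGradient D u) :=
  ⟨h.1.hasH1Grad, h.2⟩

lemma HasH10Grad.congr (h : HasH10Grad D u G)
    (hu : u =ᵐ[volume.restrict D] v) (hG : G =ᵐ[volume.restrict D] H) : HasH10Grad D v H := by
  refine ⟨h.1.congr hu hG, fun ε hε => ?_⟩
  obtain ⟨φ, h1, h2⟩ := h.2 ε hε
  refine ⟨φ, ?_, ?_⟩
  · rwa [eLpNorm_congr_ae (g := fun x => u x - φ x)]
    filter_upwards [hu] with x hx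
    rw [hx]
  · rwa [eLpNorm_congr_ae (g := fun x => G x - ∇ φ x)]
    filter_upwards [hG] with x hx
    rw [hx]

lemma HasH10Grad.exists_seq (h : HasH10Grad D u G) : ∃ φ : ℕ → TestFunction D ℝ ⊤,
    Tendsto (fun n => eLpNorm (fun x => u x - φ n x) 2 (volume.restrict D)) atTop (𝓝 0) ∧
    Tendsto (fun n => eLpNorm (fun x => G x - ∇ (φ n) x) 2 (volume.restrict D)) atTop (𝓝 0) := by
  choose! φ h1 h2 using h.2
  have h0 : Tendsto (fun n : ℕ => (n : ℝ≥0∞)⁻¹) atTop (𝓝 0) :=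
    ENNReal.tendsto_inv_nat_nhds_zero
  refine ⟨fun n => φ (n : ℝ≥0∞)⁻¹, ?_, ?_⟩
  · exact tendsto_of_tendsto_of_tendsto_of_le_of_le tendsto_const_nhds h0 (fun _ => zero_le)
      fun n => (h1 _ (by simp)).le
  · exact tendsto_of_tendsto_of_tendsto_of_le_of_le tendsto_const_nhds h0 (fun _ => zero_le)
      fun n => (h2 _ (by simp)).le

/-- A limit in `L²`, together with gradients, of test functions lies in `H¹₀`. -/
lemma HasH10Grad.of_tendsto {ι : Type*} {l : Filter ι} [l.NeBot] {φ : ι → TestFunction D ℝ ⊤}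
    (hu : MemLp u 2 (volume.restrict D)) (hG : MemLp G 2 (volume.restrict D))
    (h1 : Tendsto (fun n => eLpNorm (fun x => u x - φ n x) 2 (volume.restrict D)) l (𝓝 0))
    (h2 : Tendsto (fun n => eLpNorm (fun x => G x - ∇ (φ n) x) 2 (volume.restrict D)) l (𝓝 0)) :
    HasH10Grad D u G := by
  refine ⟨.of_tendsto (fun i => (φ i).hasH1Grad) hu hG
    (fun h hh => tendsto_integral_mul (fun i => (φ i).memLp 2 _) hu hh h1)
    (fun h hh => tendsto_integral_inner (fun i => (φ i).memLp_gradient 2 _) hG hh h2),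
    fun ε hε => ?_⟩
  obtain ⟨n, hn1, hn2⟩ := ((h1.eventually_lt_const hε).and (h2.eventually_lt_const hε)).exists
  exact ⟨φ n, hn1, hn2⟩

lemma _root_.TestFunction.hasH10Grad (φ : TestFunction D ℝ ⊤) : HasH10Grad D φ (∇ φ) :=
  ⟨φ.hasH1Grad, fun ε hε => ⟨φ, by simpa using hε, by simpa using hε⟩⟩

lemma HasH10Grad.add (h : HasH10Grad D u G) (h' : HasH10Grad D v H) :
    HasH10Grad D (fun x => u x + v x) (fun x => G x + H x) := by
  obtain ⟨φ, h1, h2⟩ := h.exists_seq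
  obtain ⟨ψ, h3, h4⟩ := h'.exists_seq
  refine .of_tendsto (l := atTop) (φ := fun n => φ n + ψ n) (h.1.memLp.add h'.1.memLp)
    (h.1.memLp_grad.add h'.1.memLp_grad) ?_ ?_
  · refine tendsto_of_tendsto_of_tendsto_of_le_of_le tendsto_const_nhds
      (by simpa using h1.add h3) (fun _ => zero_le) fun n => ?_
    refine le_trans (le_of_eq ?_) (eLpNorm_add_le (h.1.memLp.sub ((φ n).memLp 2 _)).1
      (h'.1.memLp.sub ((ψ n).memLp 2 _)).1 one_le_two)
    congr 1; ext x; simp; ring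
  · refine tendsto_of_tendsto_of_tendsto_of_le_of_le tendsto_const_nhds
      (by simpa using h2.add h4) (fun _ => zero_le) fun n => ?_
    refine le_trans (le_of_eq ?_) (eLpNorm_add_le
      (h.1.memLp_grad.sub ((φ n).memLp_gradient 2 _)).1
      (h'.1.memLp_grad.sub ((ψ n).memLp_gradient 2 _)).1 one_le_two)
    congr 1; funext x; simp only [TestFunction.gradient_add, Pi.add_apply]; abel

lemma HasH10Grad.smul (c : ℝ) (h : HasH10Grad D u G) :
    HasH10Grad D (fun x => c * u x) (fun x => c • G x) := by
  obtain ⟨φ, h1, h2⟩ := h.exists_seq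
  refine .of_tendsto (l := atTop) (φ := fun n => c • φ n) (h.1.memLp.const_mul c)
    (h.1.memLp_grad.const_smul c) ?_ ?_
  · have := ENNReal.Tendsto.const_mul (a := ‖c‖ₑ) h1 (Or.inr enorm_ne_top)
    rw [mul_zero] at this
    refine this.congr fun n => ?_
    rw [← eLpNorm_const_smul]
    congr 1; funext x; simp [mul_sub]
  · have := ENNReal.Tendsto.const_mul (a := ‖c‖ₑ) h2 (Or.inr enorm_ne_top)
    rw [mul_zero] at this
    refine this.congr fun n => ?_
    rw [← eLpNorm_const_smul]
    congr 1; funext x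
    simp only [TestFunction.gradient_smul, Pi.smul_apply, smul_sub]

end WeakGradient

/-! ### Mollification in `L²` -/

section Jensen

variable {α T F F' : Type*} [MeasurableSpace α] [MeasurableSpace T] [NormedAddCommGroup F]
  [NormedAddCommGroup F'] {μ : Measure α} {ν : Measure T}

lemma sq_lintegral_le [IsProbabilityMeasure ν] {f : T → ℝ≥0∞} (hf : AEMeasurable f ν) :
    (∫⁻ t, f t ∂ν) ^ 2 ≤ ∫⁻ t, f t ^ 2 ∂ν := by
  have h := ENNReal.lintegral_mul_le_Lp_mul_Lq ν Real.HolderConjugate.two_two hf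
    (aemeasurable_const (b := (1 : ℝ≥0∞)))
  simp only [Pi.mul_apply, mul_one, ENNReal.one_rpow, lintegral_const, measure_univ] at h
  calc (∫⁻ t, f t ∂ν) ^ 2 ≤ ((∫⁻ t, f t ^ (2 : ℝ) ∂ν) ^ (1 / (2 : ℝ))) ^ 2 := by gcongr
    _ = ∫⁻ t, f t ^ 2 ∂ν := by
      rw [← ENNReal.rpow_natCast, ← ENNReal.rpow_mul]
      norm_num

lemma eLpNorm_two_sq_eq_lintegral (g : α → F) :
    eLpNorm g 2 μ ^ 2 = ∫⁻ x, ‖g x‖ₑ ^ 2 ∂μ := by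
  simpa using eLpNorm_nnreal_pow_eq_lintegral (f := g) (μ := μ) (p := 2) two_ne_zero

/-- An average of functions, each of `L²` norm at most `C`, has `L²` norm at most `C`. -/
lemma eLpNorm_two_le_of_le_average [SFinite μ] [IsProbabilityMeasure ν] {Φ : α → F}
    {b : α → T → F'} {C : ℝ≥0∞}
    (hb : AEStronglyMeasurable (Function.uncurry b) (μ.prod ν))
    (hΦ : ∀ᵐ x ∂μ, ‖Φ x‖ₑ ≤ ∫⁻ t, ‖b x t‖ₑ ∂ν)
    (hC : ∀ᵐ t ∂ν, eLpNorm (fun x => b x t) 2 μ ≤ C) : eLpNorm Φ 2 μ ≤ C := by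
  refine (ENNReal.pow_le_pow_left_iff two_ne_zero).1 ?_
  calc eLpNorm Φ 2 μ ^ 2 = ∫⁻ x, ‖Φ x‖ₑ ^ 2 ∂μ := eLpNorm_two_sq_eq_lintegral Φ
    _ ≤ ∫⁻ x, ∫⁻ t, ‖b x t‖ₑ ^ 2 ∂ν ∂μ := by
      refine lintegral_mono_ae ?_
      filter_upwards [hΦ, hb.prodMk_left] with x hx hbx
      exact (ENNReal.pow_le_pow_left hx).trans (sq_lintegral_le hbx.enorm)
    _ = ∫⁻ t, ∫⁻ x, ‖b x t‖ₑ ^ 2 ∂μ ∂ν := lintegral_lintegral_swap (hb.enorm.pow_const 2)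
    _ ≤ ∫⁻ _, C ^ 2 ∂ν := by
      refine lintegral_mono_ae ?_
      filter_upwards [hC] with t ht
      rw [← eLpNorm_two_sq_eq_lintegral]
      exact ENNReal.pow_le_pow_left ht
    _ = C ^ 2 := by simp

end Jensen

section Mollify

variable {d : ℕ} {F : Type*} [NormedAddCommGroup F] [NormedSpace ℝ F]
  {h : EuclideanSpace ℝ (Fin d) → F}

/-- The mollification of `h` by the normalization of the bump function `ρ`. -/
noncomputable def mollify (ρ : ContDiffBump (0 : EuclideanSpace ℝ (Fin d)))
    (h : EuclideanSpace ℝ (Fin d) → F) : EuclideanSpace ℝ (Fin d) → F :=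
  convolution (ρ.normed volume) h (ContinuousLinearMap.lsmul ℝ ℝ) volume

lemma continuous_mollify (ρ : ContDiffBump (0 : EuclideanSpace ℝ (Fin d)))
    (hh : LocallyIntegrable h volume) : Continuous (mollify ρ h) :=
  ρ.hasCompactSupport_normed.continuous_convolution_left _ ρ.continuous_normed hh

lemma mollify_eq_integral (ρ : ContDiffBump (0 : EuclideanSpace ℝ (Fin d)))
    (x : EuclideanSpace ℝ (Fin d)) :
    mollify ρ h x = ∫ t, ρ.normed volume (x - t) • h t := by
  rw [mollify, convolution_eq_swap]
  rfl

/-- Translations are continuous in `L²`. -/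
lemma tendsto_eLpNorm_translate {F : Type*} [NormedAddCommGroup F]
    {h : EuclideanSpace ℝ (Fin d) → F} (hh : MemLp h 2 volume) :
    Tendsto (fun t => eLpNorm (fun x => h (x - t) - h x) 2 volume) (𝓝 0) (𝓝 0) := by
  let c : C(EuclideanSpace ℝ (Fin d) × EuclideanSpace ℝ (Fin d), EuclideanSpace ℝ (Fin d)) :=
    ⟨fun p => p.2 - p.1, by fun_prop⟩
  have hmp : ∀ t, MeasurePreserving (c.curry t) volume volume := fun t =>
    measurePreserving_sub_right volume t
  have key := Filter.Tendsto.compMeasurePreservingLp (μ := volume) (ν := volume)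
    (tendsto_const_nhds (x := hh.toLp) (f := 𝓝 (0 : EuclideanSpace ℝ (Fin d))))
    (c.curry.continuous.tendsto 0) hmp (hmp 0) ENNReal.ofNat_ne_top
  rw [tendsto_iff_edist_tendsto_0] at key
  refine key.congr fun t => ?_
  rw [Lp.toLp_compMeasurePreserving, Lp.toLp_compMeasurePreserving, Lp.edist_toLp_toLp]
  congr 1
  funext x
  simp [c]

/-- A mollification differs from the function by at most the supremum of the differences with the
translates by vectors shorter than the radius. -/
lemma eLpNorm_mollify_sub_le [CompleteSpace F] (ρ : ContDiffBump (0 : EuclideanSpace ℝ (Fin d)))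
    (hh : MemLp h 2 volume) {C : ℝ≥0∞}
    (hC : ∀ t, ‖t‖ < ρ.rOut → eLpNorm (fun x => h (x - t) - h x) 2 volume ≤ C) :
    eLpNorm (fun x => mollify ρ h x - h x) 2 volume ≤ C := by
  have hmeas : Measurable fun t => ENNReal.ofReal (ρ.normed volume t) :=
    ρ.continuous_normed.measurable.ennreal_ofReal
  -- `mollify ρ h x - h x` is the `ν`-average of `h (x - t) - h x`
  set ν : Measure (EuclideanSpace ℝ (Fin d)) :=
    volume.withDensity fun t => ENNReal.ofReal (ρ.normed volume t) with hν
  have : IsProbabilityMeasure ν := by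
    refine ⟨?_⟩
    rw [hν, withDensity_apply _ MeasurableSet.univ, Measure.restrict_univ,
      ← ofReal_integral_eq_lintegral_ofReal ρ.integrable_normed
        (Eventually.of_forall ρ.nonneg_normed), ρ.integral_normed, ENNReal.ofReal_one]
  have hac : ν ≪ volume := withDensity_absolutelyContinuous _ _
  have hb : AEStronglyMeasurable
      (Function.uncurry fun x t : EuclideanSpace ℝ (Fin d) => h (x - t) - h x)
      ((volume : Measure (EuclideanSpace ℝ (Fin d))).prod ν) := by
    have h1 : AEStronglyMeasurable
        (fun p : EuclideanSpace ℝ (Fin d) × EuclideanSpace ℝ (Fin d) => h (p.1 - p.2))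
        ((volume : Measure (EuclideanSpace ℝ (Fin d))).prod ν) :=
      hh.1.comp_quasiMeasurePreserving (quasiMeasurePreserving_sub volume ν)
    exact h1.sub hh.1.comp_fst
  refine eLpNorm_two_le_of_le_average hb (Eventually.of_forall fun x => ?_) ?_
  · have hint : Integrable fun t => ρ.normed volume t • h (x - t) :=
      ρ.hasCompactSupport_normed.convolutionExists_left (ContinuousLinearMap.lsmul ℝ ℝ)
        ρ.continuous_normed (hh.locallyIntegrable one_le_two) x
    have e : mollify ρ h x - h x = ∫ t, (h (x - t) - h x) ∂ν := by
      rw [hν, integral_withDensity_eq_integral_toReal_smul hmeas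
        (Eventually.of_forall fun _ => ENNReal.ofReal_lt_top)]
      simp only [ENNReal.toReal_ofReal (ρ.nonneg_normed _), smul_sub]
      rw [integral_sub hint (ρ.integrable_normed.smul_const _), integral_smul_const,
        ρ.integral_normed, one_smul]
      rfl
    rw [e]
    exact enorm_integral_le_lintegral_enorm _
  · rw [hν, ae_withDensity_iff hmeas]
    refine Eventually.of_forall fun t ht => hC t ?_
    by_contra hcon
    refine ht ?_
    have : t ∉ Function.support (ρ.normed volume) := by
      rw [ρ.support_normed_eq]
      simpa using hcon
    simp [Function.notMem_support.1 this]

lemma tendsto_eLpNorm_mollify_sub [CompleteSpace F] {ι : Type*} {l : Filter ι}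
    {ρ : ι → ContDiffBump (0 : EuclideanSpace ℝ (Fin d))}
    (hρ : Tendsto (fun i => (ρ i).rOut) l (𝓝 0)) (hh : MemLp h 2 volume) :
    Tendsto (fun i => eLpNorm (fun x => mollify (ρ i) h x - h x) 2 volume) l (𝓝 0) := by
  rw [ENNReal.tendsto_nhds_zero]
  intro ε hε
  have h1 := (ENNReal.tendsto_nhds_zero.1 (tendsto_eLpNorm_translate hh)) ε hε
  obtain ⟨δ, hδ, hball⟩ := Metric.eventually_nhds_iff.1 h1
  filter_upwards [hρ.eventually_lt_const hδ] with i hi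
  refine eLpNorm_mollify_sub_le (ρ i) hh fun t ht => hball ?_
  rw [dist_zero_right]
  exact ht.trans hi

end Mollify

section Gradient

variable {d : ℕ} {D : Opens (EuclideanSpace ℝ (Fin d))} {u : EuclideanSpace ℝ (Fin d) → ℝ}
  {G : EuclideanSpace ℝ (Fin d) → EuclideanSpace ℝ (Fin d)}

lemma HasH1Grad.memLp_top (h : HasH1Grad ⊤ u G) : MemLp u 2 volume := by
  simpa using h.memLp

lemma HasH1Grad.memLp_grad_top (h : HasH1Grad ⊤ u G) : MemLp G 2 volume := by
  simpa using h.memLp_grad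

lemma contDiff_mollify (ρ : ContDiffBump (0 : EuclideanSpace ℝ (Fin d)))
    (hu : LocallyIntegrable u volume) :
    ContDiff ℝ ((⊤ : ℕ∞) : WithTop ℕ∞) (mollify ρ u) :=
  ρ.hasCompactSupport_normed.contDiff_convolution_left _ ρ.contDiff_normed hu

/-- Mollification commutes with the gradient. -/
lemma HasH1Grad.gradient_mollify (h : HasH1Grad ⊤ u G)
    (ρ : ContDiffBump (0 : EuclideanSpace ℝ (Fin d))) (x : EuclideanSpace ℝ (Fin d)) :
    ∇ (mollify ρ u) x = mollify ρ G x := by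
  set r := ρ.normed volume with hr
  have hrc : ContDiff ℝ ((⊤ : ℕ∞) : WithTop ℕ∞) r := ρ.contDiff_normed
  have hrs : HasCompactSupport r := ρ.hasCompactSupport_normed
  have hr1 : ContDiff ℝ 1 r := hrc.of_le (by exact_mod_cast le_top)
  have hu : LocallyIntegrable u volume := h.memLp_top.locallyIntegrable one_le_two
  have hG : LocallyIntegrable G volume := h.memLp_grad_top.locallyIntegrable one_le_two
  refine ext_inner_right ℝ fun w => ?_
  rw [inner_gradient_left]
  have hfd := hrs.hasFDerivAt_convolution_left (ContinuousLinearMap.lsmul ℝ ℝ) hr1 hu x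
  have e1 : fderiv ℝ (mollify ρ u) x w = ∫ t, fderiv ℝ r (x - t) w * u t := by
    have hint := (hrs.fderiv ℝ).convolutionExists_left
      (ContinuousLinearMap.precompL (EuclideanSpace ℝ (Fin d)) (ContinuousLinearMap.lsmul ℝ ℝ))
      (hr1.continuous_fderiv one_ne_zero) hu x
    have hint' := hint.integrable_swap
    rw [mollify, hfd.fderiv, convolution_eq_swap, ContinuousLinearMap.integral_apply hint']
    rfl
  -- the weak gradient is tested with the reflected and translated bump function
  let ψ : TestFunction (⊤ : Opens (EuclideanSpace ℝ (Fin d))) ℝ ⊤ :=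
    ⟨fun t => r (x - t), hrc.comp (contDiff_const.sub contDiff_id),
      hrs.comp_homeomorph (Homeomorph.subLeft x), by simp⟩
  have e2 : ∀ t, fderiv ℝ ψ t w = - fderiv ℝ r (x - t) w := by
    intro t
    have h1 : HasFDerivAt (fun t : EuclideanSpace ℝ (Fin d) => x - t)
      (-ContinuousLinearMap.id ℝ (EuclideanSpace ℝ (Fin d))) t := by
      simpa using (hasFDerivAt_id t).const_sub x
    have h2 : HasFDerivAt ψ ((fderiv ℝ r (x - t)).comp
        (-ContinuousLinearMap.id ℝ (EuclideanSpace ℝ (Fin d)))) t :=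
      ((hr1.differentiable one_ne_zero (x - t)).hasFDerivAt).comp t h1
    rw [h2.fderiv]
    simp
  have e3 := h.weak.2.2 ψ w
  simp only [Opens.coe_top, Measure.restrict_univ, e2] at e3
  have e4 : inner ℝ (mollify ρ G x) w = ∫ t, inner ℝ (G t) w * ψ t := by
    have hint : Integrable fun t => r (x - t) • G t :=
      (hrs.convolutionExists_left (ContinuousLinearMap.lsmul ℝ ℝ) hrc.continuous hG
        x).integrable_swap
    rw [mollify_eq_integral, real_inner_comm, ← integral_inner hint]
    refine integral_congr_ae (Eventually.of_forall fun t => ?_)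
    simp only [inner_smul_right, real_inner_comm w]
    exact mul_comm _ _
  rw [e1, e4, ← neg_neg (∫ t, inner ℝ (G t) w * ψ t), ← e3, ← integral_neg]
  refine integral_congr_ae (Eventually.of_forall fun t => ?_)
  simp only
  ring

/-- An `H¹` function that vanishes outside a compact subset of `D` lies in `H¹₀(D)`: its
mollifications with radius less than the distance to the complement are test functions on `D`. -/
lemma HasH1Grad.hasH10Grad_of_compact (h : HasH1Grad ⊤ u G) {K : Set (EuclideanSpace ℝ (Fin d))}
    (hK : IsCompact K) (hKD : K ⊆ D) (hu : ∀ x ∉ K, u x = 0) : HasH10Grad D u G := by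
  obtain ⟨δ, hδ, hδD⟩ := hK.exists_cthickening_subset_open D.isOpen hKD
  have hpos : ∀ n : ℕ, 0 < δ / (n + 1 : ℝ) := fun n => by positivity
  let ρ : ℕ → ContDiffBump (0 : EuclideanSpace ℝ (Fin d)) := fun n =>
    ⟨δ / (n + 1 : ℝ) / 2, δ / (n + 1 : ℝ), half_pos (hpos n), half_lt_self (hpos n)⟩
  have hρ : Tendsto (fun n => (ρ n).rOut) atTop (𝓝 0) := by
    change Tendsto (fun n : ℕ => δ / (n + 1 : ℝ)) atTop (𝓝 0)
    simpa [div_eq_mul_inv] using tendsto_one_div_add_atTop_nhds_zero_nat.const_mul δ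
  have hli : LocallyIntegrable u volume := h.memLp_top.locallyIntegrable one_le_two
  have hsupp : ∀ n, tsupport (mollify (ρ n) u) ⊆ Metric.cthickening δ K := by
    intro n
    refine closure_minimal ?_ Metric.isClosed_cthickening
    refine (support_convolution_subset_swap _).trans ?_
    rintro _ ⟨a, ha, b, hb, rfl⟩
    have haK : a ∈ K := by
      by_contra hcon
      exact ha (hu a hcon)
    rw [(ρ n).support_normed_eq] at hb
    refine Metric.mem_cthickening_of_dist_le _ a δ K haK ?_
    have hb' : ‖b‖ < δ / (n + 1 : ℝ) := by simpa using hb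
    have : δ / (n + 1 : ℝ) ≤ δ := div_le_self hδ.le (by linarith [n.cast_nonneg (α := ℝ)])
    simpa using hb'.le.trans this
  let φ : ℕ → TestFunction D ℝ ⊤ := fun n =>
    ⟨mollify (ρ n) u, contDiff_mollify _ hli,
      (hK.cthickening).of_isClosed_subset (isClosed_tsupport _) (hsupp n), (hsupp n).trans hδD⟩
  have hres : ∀ {F : Type} [NormedAddCommGroup F] (f g : EuclideanSpace ℝ (Fin d) → F),
      eLpNorm (fun x => f x - g x) 2 (volume.restrict D) ≤
        eLpNorm (fun x => g x - f x) 2 volume := by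
    intro F _ f g
    rw [← eLpNorm_neg]
    refine (eLpNorm_mono_measure _ Measure.restrict_le_self).trans (le_of_eq ?_)
    congr 1
    funext x
    simp
  refine .of_tendsto (l := atTop) (φ := φ) (h.memLp_top.restrict _) (h.memLp_grad_top.restrict _)
    ?_ ?_
  · exact tendsto_of_tendsto_of_tendsto_of_le_of_le tendsto_const_nhds
      (tendsto_eLpNorm_mollify_sub hρ h.memLp_top) (fun _ => zero_le) fun n => hres _ _
  · refine tendsto_of_tendsto_of_tendsto_of_le_of_le tendsto_const_nhds
      (tendsto_eLpNorm_mollify_sub hρ h.memLp_grad_top) (fun _ => zero_le) fun n => ?_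
    refine le_trans (le_of_eq ?_) (hres G (mollify (ρ n) G))
    congr 1
    funext x
    rw [← h.gradient_mollify (ρ n) x]
    rfl

lemma memLp_smul_of_hasCompactSupport {F : Type*} [NormedAddCommGroup F] [NormedSpace ℝ F]
    {f : EuclideanSpace ℝ (Fin d) → F} (hf : MemLp f 2 (volume.restrict D))
    {ψ : EuclideanSpace ℝ (Fin d) → ℝ} (hψ : Continuous ψ) (hc : HasCompactSupport ψ)
    (h0 : ∀ x ∉ D, ψ x = 0) : MemLp (fun x => ψ x • f x) 2 volume := by
  have h1 : MemLp (ψ • f) 2 (volume.restrict D) :=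
    hf.smul (hψ.memLp_of_hasCompactSupport hc (p := ∞))
  rw [← memLp_indicator_iff_restrict D.isOpen.measurableSet] at h1
  refine (memLp_congr_ae (Eventually.of_forall fun x => ?_)).1 h1
  by_cases hx : x ∈ (D : Set (EuclideanSpace ℝ (Fin d)))
  · simp [indicator_of_mem hx]
  · simp [indicator_of_notMem hx, h0 x hx]

lemma memLp_smul_vectorField {f : EuclideanSpace ℝ (Fin d) → ℝ}
    (hf : MemLp f 2 (volume.restrict D))
    {ψ : EuclideanSpace ℝ (Fin d) → EuclideanSpace ℝ (Fin d)} (hψ : Continuous ψ)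
    (hc : HasCompactSupport ψ)
    (h0 : ∀ x ∉ D, ψ x = 0) : MemLp (fun x => f x • ψ x) 2 volume := by
  have h1 : MemLp (f • ψ) 2 (volume.restrict D) :=
    (hψ.memLp_of_hasCompactSupport hc (p := ∞)).smul hf
  rw [← memLp_indicator_iff_restrict D.isOpen.measurableSet] at h1
  refine (memLp_congr_ae (Eventually.of_forall fun x => ?_)).1 h1
  by_cases hx : x ∈ (D : Set (EuclideanSpace ℝ (Fin d)))
  · simp [indicator_of_mem hx]
  · simp [indicator_of_notMem hx, h0 x hx]

/-- The product of an `H¹(D)` function and a test function on `D`, extended by zero, is an `H¹`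
function on the whole space. -/
lemma HasH1Grad.mul_testFunction_top (h : HasH1Grad D u G) (φ : TestFunction D ℝ ⊤) :
    HasH1Grad ⊤ (fun x => φ x * u x) (fun x => φ x • G x + u x • ∇ φ x) := by
  have m1 : MemLp (fun x => φ x * u x) 2 volume :=
    memLp_smul_of_hasCompactSupport h.memLp φ.continuous φ.hasCompactSupport
      fun x hx => φ.eq_zero_of_notMem hx
  have m2 : MemLp (fun x => φ x • G x) 2 volume :=
    memLp_smul_of_hasCompactSupport h.memLp_grad φ.continuous φ.hasCompactSupport
      fun x hx => φ.eq_zero_of_notMem hx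
  have m3 : MemLp (fun x => u x • ∇ φ x) 2 volume :=
    memLp_smul_vectorField h.memLp (continuous_gradient φ.contDiff_one)
      (hasCompactSupport_gradient φ.hasCompactSupport)
      fun x hx => φ.gradient_eq_zero_of_notMem hx
  refine .of_integral (m1.restrict _) ((m2.add m3).restrict _) fun ψ w => ?_
  simp only [Opens.coe_top, Measure.restrict_univ]
  have key := h.weak.2.2 (φ.mulSmooth ψ ψ.contDiff_top) w
  have hder : ∀ x, fderiv ℝ (φ.mulSmooth ψ ψ.contDiff_top) x w =
      φ x * fderiv ℝ ψ x w + ψ x * fderiv ℝ φ x w := by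
    intro x
    have := (φ.differentiable x).hasFDerivAt.mul (ψ.differentiable x).hasFDerivAt
    rw [show ((φ.mulSmooth ψ ψ.contDiff_top : TestFunction D ℝ ⊤) :
      EuclideanSpace ℝ (Fin d) → ℝ) = φ * ψ from rfl, this.fderiv]
    simp
  have hψ := ψ.memLp 2 (volume.restrict (D : Set (EuclideanSpace ℝ (Fin d))))
  have i1 : IntegrableOn (fun x => φ x * u x * fderiv ℝ ψ x w) D :=
    integrable_mul_of_memLp (m1.restrict _) (ψ.memLp_fderiv_apply w 2 _)
  have i3 : Integrable (fun x => u x * fderiv ℝ φ x w * ψ x) (volume.restrict D) := by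
    have := integrable_mul_of_memLp (memLp_inner_const (m3.restrict D) w) hψ
    simpa [real_inner_smul_left, inner_gradient_left] using this
  have i2 : Integrable (fun x => φ x * inner ℝ (G x) w * ψ x) (volume.restrict D) := by
    have := integrable_mul_of_memLp (memLp_inner_const (m2.restrict D) w) hψ
    simpa [real_inner_smul_left] using this
  rw [← setIntegral_eq_integral_of_forall_compl_eq_zero (s := (D : Set _)),
    ← setIntegral_eq_integral_of_forall_compl_eq_zero (s := (D : Set _))
      (f := fun x => inner ℝ (φ x • G x + u x • ∇ φ x) w * ψ x)]
  · simp only [inner_add_left, real_inner_smul_left, inner_gradient_left, add_mul]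
    rw [integral_add i2 i3]
    have e1 : ∫ x in D, u x * fderiv ℝ (φ.mulSmooth ψ ψ.contDiff_top) x w =
        (∫ x in D, φ x * u x * fderiv ℝ ψ x w) + ∫ x in D, u x * fderiv ℝ φ x w * ψ x := by
      rw [← integral_add i1 i3]
      refine integral_congr_ae (Eventually.of_forall fun x => ?_)
      simp only [hder]
      ring
    have e2 : ∫ x in D, inner ℝ (G x) w * (φ.mulSmooth ψ ψ.contDiff_top) x =
        ∫ x in D, φ x * inner ℝ (G x) w * ψ x := by
      refine integral_congr_ae (Eventually.of_forall fun x => ?_)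
      simp only [TestFunction.mulSmooth_apply]
      ring
    rw [e1, e2] at key
    linarith
  · intro x hx
    simp [φ.eq_zero_of_notMem hx, φ.gradient_eq_zero_of_notMem hx]
  · intro x hx
    simp [φ.eq_zero_of_notMem hx]

lemma HasH1Grad.mul_testFunction (h : HasH1Grad D u G) (φ : TestFunction D ℝ ⊤) :
    HasH10Grad D (fun x => φ x * u x) (fun x => φ x • G x + u x • ∇ φ x) :=
  (h.mul_testFunction_top φ).hasH10Grad_of_compact φ.hasCompactSupport φ.tsupport_subset
    fun x hx => by simp [image_eq_zero_of_notMem_tsupport hx]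

end Gradient

/-! ### The chain rule -/

/-- If finitely many properties of subsequences are inherited by further subsequences and can be
achieved by passing to a subsequence, then they can be achieved simultaneously. -/
lemma exists_strictMono_forall {k : ℕ} {P : Fin k → (ℕ → ℕ) → Prop}
    (hsub : ∀ i s (t : ℕ → ℕ), StrictMono t → P i s → P i (s ∘ t))
    (hex : ∀ i (s : ℕ → ℕ), StrictMono s → ∃ t : ℕ → ℕ, StrictMono t ∧ P i (s ∘ t)) :
    ∃ s : ℕ → ℕ, StrictMono s ∧ ∀ i, P i s := by
  have key : ∀ S : Finset (Fin k), ∃ s : ℕ → ℕ, StrictMono s ∧ ∀ i ∈ S, P i s := by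
    intro S
    induction S using Finset.induction_on with
    | empty => exact ⟨id, strictMono_id, by simp⟩
    | insert a S _ ih =>
      obtain ⟨s, hs, hP⟩ := ih
      obtain ⟨t, ht, hPa⟩ := hex a s hs
      refine ⟨s ∘ t, hs.comp ht, fun i hi => ?_⟩
      rcases Finset.mem_insert.1 hi with rfl | hi
      · exact hPa
      · exact hsub i s t ht (hP i hi)
  obtain ⟨s, hs, hP⟩ := key Finset.univ
  exact ⟨s, hs, fun i => hP i (Finset.mem_univ i)⟩

section ChainRule

variable {d k : ℕ} {D : Opens (EuclideanSpace ℝ (Fin d))}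

/-- There is a cutoff function in `C_c^∞(D)` that equals `1`, with vanishing gradient, on a given
compact subset of `D`. -/
lemma exists_testFunction_eq_one {K : Set (EuclideanSpace ℝ (Fin d))} (hK : IsCompact K)
    (hKD : K ⊆ D) : ∃ χ : TestFunction D ℝ ⊤, ∀ x ∈ K, χ x = 1 ∧ ∇ χ x = 0 := by
  obtain ⟨δ, hδ, hδD⟩ := hK.exists_cthickening_subset_open D.isOpen hKD
  obtain ⟨f, hf, hr, hs, h1⟩ := exists_contMDiff_support_eq_eq_one_iff (n := ⊤)
    (modelWithCornersSelf ℝ (EuclideanSpace ℝ (Fin d)))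
    (Metric.isOpen_thickening (δ := δ) (E := K)) hK.isClosed (Metric.self_subset_thickening hδ K)
  have hts : tsupport f ⊆ Metric.cthickening δ K := by
    rw [tsupport, hs]
    exact Metric.closure_thickening_subset_cthickening δ K
  refine ⟨⟨f, hf.contDiff, hK.cthickening.of_isClosed_subset (isClosed_tsupport _) hts,
    hts.trans hδD⟩, fun x hx => ?_⟩
  have hx1 : f x = 1 := (h1 x).1 hx
  refine ⟨hx1, ?_⟩
  -- the cutoff attains its maximum `1` at the points of `K`
  have hmax : IsLocalMax f x := Eventually.of_forall fun y => by
    rw [hx1]; exact (hr ⟨y, rfl⟩).2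
  change ∇ f x = 0
  rw [gradient, hmax.fderiv_eq_zero, map_zero]

/-- A `C¹` function that is square integrable together with its gradient lies in `H¹`. -/
lemma hasH1Grad_of_hasGradientAt {w : EuclideanSpace ℝ (Fin d) → ℝ}
    {W : EuclideanSpace ℝ (Fin d) → EuclideanSpace ℝ (Fin d)}
    (hw : ∀ x, HasGradientAt w (W x) x) (hW : Continuous W)
    (hm : MemLp w 2 (volume.restrict D)) (hM : MemLp W 2 (volume.restrict D)) :
    HasH1Grad D w W := by
  refine .of_integral hm hM fun ψ v => ?_
  have hd : Differentiable ℝ w := fun x => (hw x).differentiableAt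
  have hfd : ∀ x, fderiv ℝ w x v = inner ℝ (W x) v := fun x => (hw x).fderiv_apply
  rw [setIntegral_eq_integral_of_forall_compl_eq_zero,
    setIntegral_eq_integral_of_forall_compl_eq_zero]
  · simp only [← hfd]
    refine integral_mul_fderiv_eq_neg_fderiv_mul_of_integrable ?_ ?_ ?_
      (fun x _ => hd x) (fun x _ => ψ.differentiable x)
    · simp only [hfd]
      exact ((hW.inner continuous_const).mul ψ.continuous).integrable_of_hasCompactSupport
        ψ.hasCompactSupport.mul_left
    · exact (hd.continuous.mul (ψ.continuous_fderiv_apply v)).integrable_of_hasCompactSupport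
        (ψ.hasCompactSupport_fderiv_apply v).mul_left
    · exact (hd.continuous.mul ψ.continuous).integrable_of_hasCompactSupport
        ψ.hasCompactSupport.mul_left
  · intro x hx; rw [ψ.eq_zero_of_notMem hx, mul_zero]
  · intro x hx; rw [ψ.fderiv_eq_zero_of_notMem hx]; simp

variable {u : Fin k → EuclideanSpace ℝ (Fin d) → ℝ}
  {G : Fin k → EuclideanSpace ℝ (Fin d) → EuclideanSpace ℝ (Fin d)}
  {F : (Fin k → ℝ) → ℝ} {f : Fin k → (Fin k → ℝ) → ℝ} {C : ℝ}

lemma exists_lipschitzWith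
    (hF : ∀ y, HasFDerivAt F (∑ i, f i y • (ContinuousLinearMap.proj i : (Fin k → ℝ) →L[ℝ] ℝ)) y)
    (hC : ∀ i y, |f i y| ≤ C) : ∃ K, LipschitzWith K F := by
  refine ⟨Real.toNNReal (k * |C|), lipschitzWith_of_nnnorm_fderiv_le
    (fun y => (hF y).differentiableAt) fun y => ?_⟩
  rw [(hF y).fderiv, ← NNReal.coe_le_coe, Real.coe_toNNReal _ (by positivity)]
  refine ContinuousLinearMap.opNorm_le_bound _ (by positivity) fun v => ?_
  calc ‖(∑ i, f i y • (ContinuousLinearMap.proj i : (Fin k → ℝ) →L[ℝ] ℝ)) v‖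
      = ‖∑ i, f i y * v i‖ := by simp
    _ ≤ ∑ i, ‖f i y * v i‖ := norm_sum_le _ _
    _ ≤ ∑ _i : Fin k, |C| * ‖v‖ := by
      refine Finset.sum_le_sum fun i _ => ?_
      rw [norm_mul]
      exact mul_le_mul ((hC i y).trans (le_abs_self C)) (norm_le_pi_norm v i) (norm_nonneg _)
        (abs_nonneg _)
    _ = k * |C| * ‖v‖ := by simp [mul_assoc]

variable {α : Type*} [MeasurableSpace α] {μ : Measure α}

lemma memLp_comp_lipschitz [IsFiniteMeasure μ] {K : NNReal} (hK : LipschitzWith K F)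
    {u : Fin k → α → ℝ} (hu : ∀ i, MemLp (u i) 2 μ) : MemLp (fun x => F fun i => u i x) 2 μ := by
  have h1 : LipschitzWith K fun y => F y - F 0 := fun y z => by simpa using hK y z
  have h2 : MemLp ((fun y => F y - F 0) ∘ fun x i => u i x) 2 μ :=
    h1.comp_memLp (by simp) (MemLp.of_eval hu)
  refine (memLp_congr_ae (Eventually.of_forall fun x => ?_)).1 (h2.add (memLp_const (F 0)))
  simp

lemma memLp_bounded_smul {E : Type*} [NormedAddCommGroup E] [NormedSpace ℝ E] {u : Fin k → α → ℝ}
    {g : (Fin k → ℝ) → ℝ} {h : α → E} (hg : Continuous g) (hC : ∀ y, |g y| ≤ C)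
    (hu : ∀ i, MemLp (u i) 2 μ) (hh : MemLp h 2 μ) :
    MemLp (fun x => g (fun i => u i x) • h x) 2 μ := by
  have h1 : MemLp (fun x => g fun i => u i x) ∞ μ :=
    memLp_top_of_bound (hg.comp_aestronglyMeasurable (MemLp.of_eval hu).1) C
      (Eventually.of_forall fun x => hC _)
  exact hh.smul h1

lemma memLp_sum_bounded_smul {E : Type*} [NormedAddCommGroup E] [NormedSpace ℝ E]
    {u : Fin k → α → ℝ} {G : Fin k → α → E}
    (hf : ∀ i, Continuous (f i)) (hC : ∀ i y, |f i y| ≤ C)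
    (hu : ∀ i, MemLp (u i) 2 μ) (hG : ∀ i, MemLp (G i) 2 μ) :
    MemLp (fun x => ∑ i, f i (fun l => u l x) • G i x) 2 μ :=
  memLp_finsetSum _ fun i _ => memLp_bounded_smul (hf i) (hC i) hu (hG i)

lemma hasH1Grad_comp_testFunction
    [IsFiniteMeasure (volume.restrict (D : Set (EuclideanSpace ℝ (Fin d))))]
    (hF : ∀ y, HasFDerivAt F (∑ i, f i y • (ContinuousLinearMap.proj i : (Fin k → ℝ) →L[ℝ] ℝ)) y)
    (hf : ∀ i, Continuous (f i)) (hC : ∀ i y, |f i y| ≤ C) (θ : Fin k → TestFunction D ℝ ⊤) :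
    HasH1Grad D (fun x => F fun i => θ i x) (fun x => ∑ i, f i (fun l => θ l x) • ∇ (θ i) x) := by
  obtain ⟨K, hK⟩ := exists_lipschitzWith hF hC
  refine hasH1Grad_of_hasGradientAt (fun x => ?_) ?_
    (memLp_comp_lipschitz hK fun i => (θ i).memLp 2 _)
    (memLp_sum_bounded_smul hf hC (fun i => (θ i).memLp 2 _) fun i => (θ i).memLp_gradient 2 _)
  · rw [hasGradientAt_iff_hasFDerivAt]
    have h1 : HasFDerivAt (fun x i => θ i x) (ContinuousLinearMap.pi fun i => fderiv ℝ (θ i) x) x :=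
      hasFDerivAt_pi.2 fun i => ((θ i).differentiable x).hasFDerivAt
    have h2 := (hF fun i => θ i x).comp x h1
    refine h2.congr_fderiv ?_
    ext v
    simp
  · refine continuous_finsetSum _ fun i _ => ((hf i).comp ?_).smul
      (continuous_gradient (θ i).contDiff_one)
    exact continuous_pi fun l => (θ l).continuous

/-- The chain rule in `H¹₀`, by approximation with test functions. `F` is Lipschitz, so the
compositions converge in `L²`; the gradients converge weakly, since along a subsequence the
partial derivatives of `F` converge almost everywhere and they are bounded. -/
lemma HasH10Grad.comp [IsFiniteMeasure (volume.restrict (D : Set (EuclideanSpace ℝ (Fin d))))]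
    (h : ∀ i, HasH10Grad D (u i) (G i))
    (hF : ∀ y, HasFDerivAt F (∑ i, f i y • (ContinuousLinearMap.proj i : (Fin k → ℝ) →L[ℝ] ℝ)) y)
    (hf : ∀ i, Continuous (f i)) (hC : ∀ i y, |f i y| ≤ C) :
    HasH1Grad D (fun x => F fun i => u i x) (fun x => ∑ i, f i (fun l => u l x) • G i x) := by
  obtain ⟨K, hK⟩ := exists_lipschitzWith hF hC
  set μ := volume.restrict (D : Set (EuclideanSpace ℝ (Fin d))) with hμ
  choose θ' hθu' hθG' using fun i => (h i).exists_seq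
  obtain ⟨s, hs, hae⟩ := exists_strictMono_forall
    (P := fun i s => ∀ᵐ x ∂μ, Tendsto (fun n => θ' i (s n) x) atTop (𝓝 (u i x)))
    (fun i s t ht hP => by
      filter_upwards [hP] with x hx using hx.comp ht.tendsto_atTop)
    (fun i s hs => by
      have : TendstoInMeasure μ (fun n x => θ' i (s n) x) atTop (u i) := by
        refine tendstoInMeasure_of_tendsto_eLpNorm two_ne_zero
          (fun n => ((θ' i (s n)).memLp 2 μ).1) (h i).1.memLp.1 ?_
        refine ((hθu' i).comp hs.tendsto_atTop).congr fun n => ?_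
        rw [eLpNorm_sub_comm]
        rfl
      exact this.exists_seq_tendsto_ae)
  set θ := fun (n : ℕ) (i : Fin k) => θ' i (s n) with hθ
  have hθu : ∀ i, Tendsto (fun n => eLpNorm (fun x => u i x - θ n i x) 2 μ) atTop (𝓝 0) :=
    fun i => (hθu' i).comp hs.tendsto_atTop
  have hθG : ∀ i, Tendsto (fun n => eLpNorm (fun x => G i x - ∇ (θ n i) x) 2 μ) atTop (𝓝 0) :=
    fun i => (hθG' i).comp hs.tendsto_atTop
  have hu : ∀ i, MemLp (u i) 2 μ := fun i => (h i).1.memLp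
  have hG : ∀ i, MemLp (G i) 2 μ := fun i => (h i).1.memLp_grad
  refine .of_tendsto (l := atTop) (fun n => hasH1Grad_comp_testFunction hF hf hC (θ n))
    (memLp_comp_lipschitz hK hu) (memLp_sum_bounded_smul hf hC hu hG) (fun g hg => ?_)
    (fun g hg => ?_)
  · refine tendsto_integral_mul (fun n => memLp_comp_lipschitz hK fun i => (θ n i).memLp 2 _)
      (memLp_comp_lipschitz hK hu) hg ?_
    have hsum : Tendsto (fun n => ENNReal.ofReal K *
        ∑ i, eLpNorm (fun x => u i x - θ n i x) 2 μ) atTop (𝓝 0) := by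
      have h1 : Tendsto (fun n => ∑ i, eLpNorm (fun x => u i x - θ n i x) 2 μ) atTop (𝓝 0) := by
        simpa using tendsto_finsetSum Finset.univ fun i _ => hθu i
      simpa using ENNReal.Tendsto.const_mul (a := ENNReal.ofReal K) h1
        (Or.inr ENNReal.ofReal_ne_top)
    refine tendsto_of_tendsto_of_tendsto_of_le_of_le tendsto_const_nhds hsum (fun _ => zero_le)
      fun n => ?_
    have h2 : eLpNorm (∑ i, fun x => ‖u i x - θ n i x‖) 2 μ ≤
        ∑ i, eLpNorm (fun x => u i x - θ n i x) 2 μ := by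
      refine (eLpNorm_sum_le (fun i _ => ((hu i).sub ((θ n i).memLp 2 μ)).1.norm)
        one_le_two).trans (le_of_eq ?_)
      exact Finset.sum_congr rfl fun i _ => eLpNorm_norm _
    refine le_trans ?_ (mul_le_mul_right h2 _)
    refine eLpNorm_le_mul_eLpNorm_of_ae_le_mul (Eventually.of_forall fun x => ?_) 2
    have hnn : (0 : ℝ) ≤ ∑ i, ‖u i x - θ n i x‖ := Finset.sum_nonneg fun _ _ => norm_nonneg _
    rw [← dist_eq_norm, Finset.sum_apply, Real.norm_of_nonneg hnn]
    refine (hK.dist_le_mul _ _).trans (mul_le_mul_of_nonneg_left ?_ K.2)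
    rw [dist_eq_norm, pi_norm_le_iff_of_nonneg hnn]
    exact fun i => Finset.single_le_sum (f := fun i => ‖u i x - θ n i x‖)
      (fun _ _ => norm_nonneg _) (Finset.mem_univ i)
  · -- `f_i(θ_n) ∇θ_n = f_i(θ_n) (∇θ_n - G_i) + f_i(θ_n) G_i`: the first term tends to `0` in `L²`,
    -- the second one converges by dominated convergence
    have hterm : ∀ i, Tendsto
        (fun n => ∫ x, inner ℝ (f i (fun l => θ n l x) • ∇ (θ n i) x) (g x) ∂μ)
        atTop (𝓝 (∫ x, inner ℝ (f i (fun l => u l x) • G i x) (g x) ∂μ)) := by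
      intro i
      have hfg : ∀ n, MemLp (fun x => f i (fun l => θ n l x) • g x) 2 μ := fun n =>
        memLp_bounded_smul (hf i) (hC i) (fun l => (θ n l).memLp 2 _) hg
      have hfG : ∀ n, MemLp (fun x => f i (fun l => θ n l x) • G i x) 2 μ := fun n =>
        memLp_bounded_smul (hf i) (hC i) (fun l => (θ n l).memLp 2 _) (hG i)
      have hfθ : ∀ n, MemLp (fun x => f i (fun l => θ n l x) • ∇ (θ n i) x) 2 μ := fun n =>
        memLp_bounded_smul (hf i) (hC i) (fun l => (θ n l).memLp 2 _) ((θ n i).memLp_gradient 2 _)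
      have t1 : Tendsto (fun n => ∫ x, inner ℝ (f i (fun l => θ n l x) • G i x) (g x) ∂μ)
          atTop (𝓝 (∫ x, inner ℝ (f i (fun l => u l x) • G i x) (g x) ∂μ)) := by
        refine tendsto_integral_of_dominated_convergence
          (fun x => |C| * |inner ℝ (G i x) (g x)|)
          (fun n => (integrable_inner_of_memLp (hfG n) hg).1)
          ((integrable_inner_of_memLp (hG i) hg).abs.const_mul |C|)
          (fun n => Eventually.of_forall fun x => ?_) ?_
        · rw [real_inner_smul_left, norm_mul]
          exact mul_le_mul_of_nonneg_right ((hC i _).trans (le_abs_self C)) (abs_nonneg _)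
        · filter_upwards [ae_all_iff.2 hae] with x hx
          have h1 : Tendsto (fun n l => θ n l x) atTop (𝓝 fun l => u l x) :=
            tendsto_pi_nhds.2 fun l => hx l
          exact ((((hf i).tendsto _).comp h1).smul_const (G i x)).inner tendsto_const_nhds
      have t2 : Tendsto (fun n => (∫ x, inner ℝ (f i (fun l => θ n l x) • ∇ (θ n i) x) (g x) ∂μ)
          - ∫ x, inner ℝ (f i (fun l => θ n l x) • G i x) (g x) ∂μ) atTop (𝓝 0) := by
        have hb : Tendsto (fun n => |C| * (eLpNorm (fun x => G i x - ∇ (θ n i) x) 2 μ).toReal *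
            (eLpNorm g 2 μ).toReal) atTop (𝓝 0) := by
          simpa using (((ENNReal.tendsto_toReal ENNReal.zero_ne_top).comp (hθG i)).const_mul
            |C|).mul_const (eLpNorm g 2 μ).toReal
        refine squeeze_zero_norm (fun n => ?_) hb
        rw [← integral_sub (integrable_inner_of_memLp (hfθ n) hg)
          (integrable_inner_of_memLp (hfG n) hg)]
        simp_rw [← inner_sub_left]
        refine (abs_integral_inner_le ((hfθ n).sub (hfG n)) hg).trans ?_
        refine mul_le_mul_of_nonneg_right ?_ ENNReal.toReal_nonneg
        have hfin : eLpNorm (fun x => G i x - ∇ (θ n i) x) 2 μ ≠ ∞ :=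
          ((hG i).sub ((θ n i).memLp_gradient 2 μ)).2.ne
        rw [← ENNReal.toReal_ofReal (abs_nonneg C), ← ENNReal.toReal_mul]
        refine ENNReal.toReal_mono (ENNReal.mul_ne_top ENNReal.ofReal_ne_top hfin) ?_
        refine eLpNorm_le_mul_eLpNorm_of_ae_le_mul (Eventually.of_forall fun x => ?_) 2
        rw [Pi.sub_apply, ← smul_sub, norm_smul, norm_sub_rev (G i x)]
        exact mul_le_mul_of_nonneg_right ((hC i _).trans (le_abs_self C)) (norm_nonneg _)
      simpa using t2.add t1
    have hsplit : ∀ (v : Fin k → EuclideanSpace ℝ (Fin d) → ℝ)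
        (H : Fin k → EuclideanSpace ℝ (Fin d) → EuclideanSpace ℝ (Fin d)),
        (∀ i, MemLp (v i) 2 μ) → (∀ i, MemLp (H i) 2 μ) →
        ∫ x, inner ℝ (∑ i, f i (fun l => v l x) • H i x) (g x) ∂μ =
        ∑ i, ∫ x, inner ℝ (f i (fun l => v l x) • H i x) (g x) ∂μ := by
      intro v H hv hH
      simp_rw [sum_inner]
      exact integral_finsetSum _ fun i _ =>
        integrable_inner_of_memLp (memLp_bounded_smul (hf i) (hC i) hv (hH i)) hg
    rw [hsplit u G hu hG]
    refine (tendsto_finsetSum Finset.univ fun i _ => hterm i).congr fun n => ?_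
    exact (hsplit _ _ (fun l => (θ n l).memLp 2 μ) fun l => (θ n l).memLp_gradient 2 μ).symm

/-- The chain rule for a `C¹` function with bounded derivatives of several `H¹` functions. -/
lemma HasH1Grad.comp [IsFiniteMeasure (volume.restrict (D : Set (EuclideanSpace ℝ (Fin d))))]
    (h : ∀ i, HasH1Grad D (u i) (G i))
    (hF : ∀ y, HasFDerivAt F (∑ i, f i y • (ContinuousLinearMap.proj i : (Fin k → ℝ) →L[ℝ] ℝ)) y)
    (hf : ∀ i, Continuous (f i)) (hC : ∀ i y, |f i y| ≤ C) :
    HasH1Grad D (fun x => F fun i => u i x) (fun x => ∑ i, f i (fun l => u l x) • G i x) := by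
  obtain ⟨K, hK⟩ := exists_lipschitzWith hF hC
  refine .of_integral (memLp_comp_lipschitz hK fun i => (h i).memLp)
    (memLp_sum_bounded_smul hf hC (fun i => (h i).memLp) fun i => (h i).memLp_grad) fun ψ w => ?_
  -- multiplied by a cutoff that equals `1` on the support of `ψ`, the functions lie in `H¹₀(D)`
  obtain ⟨χ, hχ⟩ := exists_testFunction_eq_one ψ.hasCompactSupport ψ.tsupport_subset
  have key := (HasH10Grad.comp (fun i => (h i).mul_testFunction χ) hF hf hC).weak.2.2 ψ w
  have e1 : ∀ x, (F fun i => u i x) * fderiv ℝ ψ x w =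
      (F fun i => χ x * u i x) * fderiv ℝ ψ x w := by
    intro x
    by_cases hx : x ∈ tsupport ψ
    · simp [(hχ x hx).1]
    · rw [image_eq_zero_of_notMem_tsupport (f := fderiv ℝ ψ)
        fun hx' => hx (tsupport_fderiv_subset ℝ hx')]
      simp
  have e2 : ∀ x, inner ℝ (∑ i, f i (fun l => u l x) • G i x) w * ψ x =
      inner ℝ (∑ i, f i (fun l => χ x * u l x) • (χ x • G i x + u i x • ∇ χ x)) w * ψ x := by
    intro x
    by_cases hx : x ∈ tsupport ψ
    · simp [hχ x hx]
    · rw [image_eq_zero_of_notMem_tsupport hx]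
      simp
  simp only [e1, e2]
  exact key

end ChainRule

/-! ### Variations of a minimizer -/

section Variation

variable {d k n : ℕ} {D : Opens (EuclideanSpace ℝ (Fin d))} {A : Fin n → Finset (Fin k)}
  {Λ : Fin n → ℝ} {U g W : EuclideanSpace ℝ (Fin d) → EuclideanSpace ℝ (Fin k)}

lemma energy_eq {G : Fin k → EuclideanSpace ℝ (Fin d) → EuclideanSpace ℝ (Fin d)}
    (h : ∀ i, HasH1Grad D (fun x => W x i) (G i)) :
    energy D A Λ W = (∑ i, ∫ x in D, ‖G i x‖ ^ 2) + ∑ j, Λ j * volume.real (phase D A W j) := by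
  rw [energy, integral_finsetSum _ fun i _ => ?_]
  · congr 1
    refine Finset.sum_congr rfl fun i _ => integral_congr_ae ?_
    filter_upwards [(h i).weakGradient_ae_eq] with x hx
    rw [hx]
  · exact ((h i).memH1.hasH1Grad.memLp_grad).integrable_norm_pow two_ne_zero

/-- Monotonicity of the measure of a phase; finiteness matters because `volume.real` of a set of
infinite measure is `0`. -/
lemma measureReal_phase_le [IsFiniteMeasure (volume.restrict (D : Set (EuclideanSpace ℝ (Fin d))))]
    {j : Fin n} (h : ∀ᵐ x ∂volume.restrict (D : Set (EuclideanSpace ℝ (Fin d))),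
      x ∈ phase D A W j → x ∈ phase D A U j) :
    volume.real (phase D A W j) ≤ volume.real (phase D A U j) := by
  have hfin : volume (phase D A U j) ≠ ∞ := by
    refine ne_top_of_le_ne_top (measure_ne_top
      (volume.restrict (D : Set (EuclideanSpace ℝ (Fin d)))) univ) ?_
    rw [Measure.restrict_apply_univ]
    exact measure_mono fun x hx => hx.1
  refine ENNReal.toReal_mono hfin (measure_mono_ae ?_)
  rw [ae_restrict_iff' D.isOpen.measurableSet] at h
  filter_upwards [h] with x hx hxW
  exact hx hxW.1 hxW

lemma eq_zero_of_forall_quadratic_nonneg {a b : ℝ} (h : ∀ t : ℝ, 0 ≤ 2 * t * a + t ^ 2 * b) :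
    a = 0 := by
  -- at this `t` the value is negative unless `a = 0`, whatever the sign of `b`
  have h1 := h (-a / (|b| + 1))
  have hb : 0 < |b| + 1 := by positivity
  have e : 2 * (-a / (|b| + 1)) * a + (-a / (|b| + 1)) ^ 2 * b =
      a ^ 2 * (b - 2 * (|b| + 1)) / (|b| + 1) ^ 2 := by
    field_simp
    ring
  rw [e] at h1
  by_contra hne
  have : a ^ 2 * (b - 2 * (|b| + 1)) < 0 :=
    mul_neg_of_pos_of_neg (by positivity) (by linarith [le_abs_self b, abs_nonneg b])
  exact absurd h1 (not_le.2 (div_neg_of_neg_of_pos this (by positivity)))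

/-- The components of a minimizer are harmonic on their phases: adding a multiple of an
`H¹₀` function that vanishes outside the phase preserves the constraint and does not enlarge any
phase. -/
lemma IsMinimizer.isHarmonicOn
    [IsFiniteMeasure (volume.restrict (D : Set (EuclideanSpace ℝ (Fin d))))]
    (hA : ∀ i, ∃! j, i ∈ A j) (hΛ : ∀ j, 0 < Λ j) (hU : IsMinimizer D A Λ g U)
    {j : Fin n} {i : Fin k} (hi : i ∈ A j) :
    IsHarmonicOn D (phase D A U j) fun x => U x i := by
  refine ⟨hU.1.1.1 i, fun v ⟨hv, hv0⟩ => eq_zero_of_forall_quadratic_nonneg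
    (b := ∫ x in D, ‖weakGradient D v x‖ ^ 2) fun t => ?_⟩
  have huG : ∀ l, HasH1Grad D (fun x => U x l) (weakGradient D fun x => U x l) :=
    fun l => (hU.1.1.1 l).hasH1Grad
  have hvG := hv.hasH10Grad
  let W : EuclideanSpace ℝ (Fin d) → EuclideanSpace ℝ (Fin k) :=
    fun x => WithLp.toLp 2 fun l => if l = i then U x l + t * v x else U x l
  let H : Fin k → EuclideanSpace ℝ (Fin d) → EuclideanSpace ℝ (Fin d) := fun l x =>
    if l = i then weakGradient D (fun x => U x l) x + t • weakGradient D v x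
    else weakGradient D (fun x => U x l) x
  have hWH : ∀ l, HasH1Grad D (fun x => W x l) (H l) := by
    intro l
    by_cases hl : l = i
    · simp only [W, H, if_pos hl]
      exact (huG l).add (hvG.1.smul t)
    · simp only [W, H, if_neg hl]
      exact huG l
  have hadm : IsAdmissible D A g W := by
    refine ⟨⟨fun l => (hWH l).memH1, ?_⟩, fun l => ?_⟩
    · filter_upwards [hU.1.1.2, hv0, self_mem_ae_restrict D.isOpen.measurableSet]
        with x hx hvx hxD j₁ j₂ hne a ha b hb
      -- where `v` does not vanish, all components outside the group of `i` do
      have key : ∀ j', j' ≠ j → ∀ b ∈ A j', (U x i + t * v x) * U x b = 0 := by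
        intro j' hj' b hb
        rw [add_mul, hx j j' hj'.symm i hi b hb, zero_add]
        by_cases hxP : x ∈ phase D A U j
        · obtain ⟨-, i', hi', hne'⟩ := hxP
          rcases mul_eq_zero.1 (hx j j' hj'.symm i' hi' b hb) with h | h
          · exact absurd h hne'
          · rw [h, mul_zero]
        · rw [hvx hxP]; ring
      have hj : ∀ j', i ∈ A j' → j' = j := fun j' h => (hA i).unique h hi
      simp only [W]
      by_cases hai : a = i <;> by_cases hbi : b = i
      · subst hai; subst hbi
        exact absurd ((hj _ ha).trans (hj _ hb).symm) hne
      · subst hai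
        obtain rfl := hj _ ha
        simpa [hbi] using key j₂ hne.symm b hb
      · subst hbi
        obtain rfl := hj _ hb
        simpa [hai, mul_comm] using key j₁ hne a ha
      · simpa [hai, hbi] using hx j₁ j₂ hne a ha b hb
    · by_cases hl : l = i
      · have := ((hU.1.2 l).hasH10Grad.add (hvG.smul t)).memH10
        have e : (fun x => W x l - g x l) = fun x => U x l - g x l + t * v x := by
          funext x
          simp only [W, if_pos hl]
          ring
        rwa [e]
      · simpa only [W, if_neg hl] using hU.1.2 l
  have hphase : ∀ j', volume.real (phase D A W j') ≤ volume.real (phase D A U j') := by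
    intro j'
    refine measureReal_phase_le ?_
    filter_upwards [hv0] with x hvx hxW
    obtain ⟨hxD, l, hl, hne⟩ := hxW
    by_cases hli : l = i
    · subst hli
      obtain rfl := (hA l).unique hl hi
      by_contra hcon
      have h1 : U x l = 0 := by
        by_contra h
        exact hcon ⟨hxD, l, hl, h⟩
      simp [W, hvx hcon, h1] at hne
    · exact ⟨hxD, l, hl, by simpa [W, hli] using hne⟩
  have hmin := hU.2 W hadm
  rw [energy_eq huG, energy_eq hWH] at hmin
  have hsum : ∑ j', Λ j' * volume.real (phase D A W j') ≤
      ∑ j', Λ j' * volume.real (phase D A U j') :=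
    Finset.sum_le_sum fun j' _ => mul_le_mul_of_nonneg_left (hphase j') (hΛ j').le
  -- only the `i`-th term of the Dirichlet integral changes, and it does so by a quadratic in `t`
  have hsq : ∀ l, (∫ x in D, ‖H l x‖ ^ 2) = (∫ x in D, ‖weakGradient D (fun x => U x l) x‖ ^ 2) +
      if l = i then 2 * t * (∫ x in D, inner ℝ (weakGradient D (fun x => U x i) x)
        (weakGradient D v x)) + t ^ 2 * ∫ x in D, ‖weakGradient D v x‖ ^ 2 else 0 := by
    intro l
    by_cases hl : l = i
    · subst hl
      simp only [H, if_true]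
      have i1 := (huG l).memLp_grad.integrable_norm_pow two_ne_zero
      have i2 := (integrable_inner_of_memLp (huG l).memLp_grad hvG.1.memLp_grad).const_mul (2 * t)
      have i3 := (hvG.1.memLp_grad.integrable_norm_pow two_ne_zero).const_mul (t ^ 2)
      rw [← integral_const_mul, ← integral_const_mul, ← integral_add i2 i3, ← integral_add i1]
      · refine integral_congr_ae (Eventually.of_forall fun x => ?_)
        simp only [norm_add_sq_real, norm_smul, mul_pow, inner_smul_right, Real.norm_eq_abs,
          sq_abs]
        ring
      · exact i2.add i3
    · simp only [H, if_neg hl, add_zero]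
  simp only [hsq, Finset.sum_add_distrib, Finset.sum_ite_eq', Finset.mem_univ, if_true] at hmin
  linarith

end Variation

/-! ### Norms of harmonic functions -/

section Laplacian

variable {d : ℕ} {D : Opens (EuclideanSpace ℝ (Fin d))}

lemma laplacian_testFunction_eq (φ : TestFunction D ℝ ⊤) (x : EuclideanSpace ℝ (Fin d)) :
    Δ (φ : EuclideanSpace ℝ (Fin d) → ℝ) x =
      ∑ i, fderiv ℝ (φ.dirDeriv (EuclideanSpace.basisFun (Fin d) ℝ i)) x
        (EuclideanSpace.basisFun (Fin d) ℝ i) := by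
  rw [InnerProductSpace.laplacian_eq_iteratedFDeriv_orthonormalBasis _
    (EuclideanSpace.basisFun (Fin d) ℝ)]
  refine Finset.sum_congr rfl fun i _ => ?_
  have hd : DifferentiableAt ℝ (fderiv ℝ φ) x :=
    ((φ.contDiff_top.fderiv_right (m := ((⊤ : ℕ∞) : WithTop ℕ∞)) (by rfl)).differentiable
      (by simp)) x
  have : fderiv ℝ (φ.dirDeriv (EuclideanSpace.basisFun (Fin d) ℝ i)) x =
      (fderiv ℝ (fderiv ℝ φ) x).flip (EuclideanSpace.basisFun (Fin d) ℝ i) := by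
    change fderiv ℝ (fun y => fderiv ℝ φ y _) x = _
    rw [fderiv_clm_apply hd (differentiableAt_const _)]
    simp
  rw [this, iteratedFDeriv_two_apply]
  simp

lemma memLp_laplacian (φ : TestFunction D ℝ ⊤) :
    MemLp (Δ (φ : EuclideanSpace ℝ (Fin d) → ℝ)) 2 (volume.restrict D) := by
  have : Δ (φ : EuclideanSpace ℝ (Fin d) → ℝ) = fun x => ∑ i,
      fderiv ℝ (φ.dirDeriv (EuclideanSpace.basisFun (Fin d) ℝ i)) x
        (EuclideanSpace.basisFun (Fin d) ℝ i) := funext (laplacian_testFunction_eq φ)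
  rw [this]
  exact memLp_finsetSum _ fun i _ => TestFunction.memLp_fderiv_apply _ _ 2 _

/-- Integration by parts against the Laplacian of a test function. -/
lemma HasH1Grad.integral_mul_laplacian {w : EuclideanSpace ℝ (Fin d) → ℝ}
    {W : EuclideanSpace ℝ (Fin d) → EuclideanSpace ℝ (Fin d)} (h : HasH1Grad D w W)
    (φ : TestFunction D ℝ ⊤) :
    ∫ x in D, w x * Δ (φ : EuclideanSpace ℝ (Fin d) → ℝ) x =
      - ∫ x in D, inner ℝ (W x) (∇ φ x) := by
  have hin : ∀ x, inner ℝ (W x) (∇ φ x) =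
      ∑ i, inner ℝ (W x) (EuclideanSpace.basisFun (Fin d) ℝ i) *
        φ.dirDeriv (EuclideanSpace.basisFun (Fin d) ℝ i) x := by
    intro x
    rw [← (EuclideanSpace.basisFun (Fin d) ℝ).sum_inner_mul_inner (W x)]
    refine Finset.sum_congr rfl fun i _ => ?_
    rw [real_inner_comm (∇ φ x), inner_gradient_left]
    rfl
  simp only [laplacian_testFunction_eq, Finset.mul_sum, hin]
  rw [integral_finsetSum _ fun i _ =>
      integrable_mul_of_memLp h.memLp (TestFunction.memLp_fderiv_apply _ _ 2 _),
    integral_finsetSum _ fun i _ => integrable_mul_of_memLp (memLp_inner_const h.memLp_grad _)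
      (TestFunction.memLp _ 2 _), ← Finset.sum_neg_distrib]
  exact Finset.sum_congr rfl fun i _ => h.weak.2.2 _ _

end Laplacian

section RegularizedNorm

variable {k : ℕ} (S : Finset (Fin k)) (ε : ℝ)

/-- The smooth approximation `√(∑_{l ∈ S} y_l² + ε²)` of the Euclidean norm of the components
in `S`. -/
noncomputable def regNorm (y : Fin k → ℝ) : ℝ := √((∑ l ∈ S, y l ^ 2) + ε ^ 2)

variable {S ε}

lemma regNorm_sq (y : Fin k → ℝ) : regNorm S ε y ^ 2 = (∑ l ∈ S, y l ^ 2) + ε ^ 2 :=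
  Real.sq_sqrt (by positivity)

lemma le_regNorm (y : Fin k → ℝ) : ε ≤ regNorm S ε y :=
  Real.le_sqrt_of_sq_le (by linarith [Finset.sum_nonneg fun l (_ : l ∈ S) => sq_nonneg (y l)])

lemma regNorm_pos (hε : 0 < ε) (y : Fin k → ℝ) : 0 < regNorm S ε y :=
  hε.trans_le (le_regNorm y)

lemma abs_le_regNorm {l : Fin k} (hl : l ∈ S) (y : Fin k → ℝ) : |y l| ≤ regNorm S ε y :=
  Real.abs_le_sqrt (by
    linarith [Finset.single_le_sum (f := fun l => y l ^ 2) (fun l _ => sq_nonneg (y l)) hl,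
      sq_nonneg ε])

lemma abs_regNorm_sub_le (hε : 0 < ε) (y : Fin k → ℝ) :
    |regNorm S ε y - √(∑ l ∈ S, y l ^ 2)| ≤ ε := by
  have h0 : 0 ≤ ∑ l ∈ S, y l ^ 2 := Finset.sum_nonneg fun l _ => sq_nonneg (y l)
  have h1 : √(∑ l ∈ S, y l ^ 2) ≤ regNorm S ε y := Real.sqrt_le_sqrt (by linarith [sq_nonneg ε])
  have h2 : regNorm S ε y ≤ √(∑ l ∈ S, y l ^ 2) + ε := by
    refine Real.sqrt_le_iff.2 ⟨by positivity, ?_⟩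
    nlinarith [Real.sq_sqrt h0, Real.sqrt_nonneg (∑ l ∈ S, y l ^ 2)]
  rw [abs_of_nonneg (by linarith)]
  linarith

lemma continuous_regNorm : Continuous (regNorm S ε) := by
  unfold regNorm
  fun_prop

lemma hasFDerivAt_regNorm (hε : 0 < ε) (y : Fin k → ℝ) :
    HasFDerivAt (regNorm S ε) (∑ l, (if l ∈ S then y l / regNorm S ε y else 0) •
      (ContinuousLinearMap.proj l : (Fin k → ℝ) →L[ℝ] ℝ)) y := by
  have h1 : HasFDerivAt (fun y : Fin k → ℝ => (∑ l ∈ S, y l ^ 2) + ε ^ 2)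
      (∑ l ∈ S, (2 * y l) • (ContinuousLinearMap.proj l : (Fin k → ℝ) →L[ℝ] ℝ)) y := by
    refine HasFDerivAt.add_const _ (HasFDerivAt.fun_sum fun l _ => ?_)
    simpa using (hasFDerivAt_apply (𝕜 := ℝ) (F' := fun _ : Fin k => ℝ) l y).pow 2
  have hne : (∑ l ∈ S, y l ^ 2) + ε ^ 2 ≠ 0 := by
    rw [← regNorm_sq]
    exact (pow_pos (regNorm_pos hε y) 2).ne'
  refine (h1.sqrt hne).congr_fderiv ?_
  change (1 / (2 * regNorm S ε y)) • _ = _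
  have hN := (regNorm_pos (S := S) hε y).ne'
  ext v
  simp only [smul_apply, sum_apply, ContinuousLinearMap.proj_apply,
    smul_eq_mul, ite_mul, zero_mul, Finset.sum_ite_mem, Finset.univ_inter, Finset.mul_sum]
  refine Finset.sum_congr rfl fun l _ => ?_
  field_simp

/-- The partial derivative in direction `l` of `y ↦ y_i / regNorm S ε y`. -/
noncomputable def quotDeriv (S : Finset (Fin k)) (ε : ℝ) (i l : Fin k) (y : Fin k → ℝ) : ℝ :=
  (if l = i then 1 / regNorm S ε y else 0) -
    if l ∈ S then y i * y l / regNorm S ε y ^ 3 else 0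

lemma hasFDerivAt_div_regNorm (hε : 0 < ε) (i : Fin k) (y : Fin k → ℝ) :
    HasFDerivAt (fun y => y i / regNorm S ε y) (∑ l, quotDeriv S ε i l y •
      (ContinuousLinearMap.proj l : (Fin k → ℝ) →L[ℝ] ℝ)) y := by
  have hN := (regNorm_pos (S := S) hε y).ne'
  have h1 := (hasFDerivAt_apply (𝕜 := ℝ) (F' := fun _ : Fin k => ℝ) i y).mul
    ((hasDerivAt_inv hN).comp_hasFDerivAt y (hasFDerivAt_regNorm (S := S) hε y))
  simp only [div_eq_mul_inv]
  refine h1.congr_fderiv ?_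
  ext v
  simp only [quotDeriv, smul_apply, sum_apply, add_apply, ContinuousLinearMap.proj_apply,
    smul_eq_mul, ite_mul, zero_mul, Finset.sum_ite_mem, Finset.univ_inter, sub_mul,
    Finset.sum_sub_distrib, Finset.sum_ite_eq', Finset.mem_univ, if_true, Function.comp_apply]
  rw [add_comm, sub_eq_add_neg, Finset.mul_sum, Finset.mul_sum, ← Finset.sum_neg_distrib]
  congr 1
  · field_simp
  · refine Finset.sum_congr rfl fun l _ => ?_
    field_simp

lemma continuous_quotDeriv (hε : 0 < ε) (i l : Fin k) : Continuous (quotDeriv S ε i l) := by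
  have hN : ∀ y, regNorm S ε y ≠ 0 := fun y => (regNorm_pos hε y).ne'
  have hc := continuous_regNorm (S := S) (ε := ε)
  unfold quotDeriv
  refine Continuous.sub ?_ ?_
  · split_ifs
    · exact continuous_const.div hc hN
    · exact continuous_const
  · split_ifs
    · exact ((continuous_apply i).mul (continuous_apply l)).div (hc.pow 3)
        fun y => pow_ne_zero 3 (hN y)
    · exact continuous_const

lemma abs_quotDeriv_le (hε : 0 < ε) {i : Fin k} (hi : i ∈ S) (l : Fin k) (y : Fin k → ℝ) :
    |quotDeriv S ε i l y| ≤ 2 / ε := by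
  have hN := regNorm_pos (S := S) hε y
  have h1 : 1 / regNorm S ε y ≤ 1 / ε := one_div_le_one_div_of_le hε (le_regNorm y)
  have h2 : |if l = i then 1 / regNorm S ε y else 0| ≤ 1 / ε := by
    split_ifs
    · rwa [abs_of_pos (by positivity)]
    · simpa using hε.le
  have h3 : |if l ∈ S then y i * y l / regNorm S ε y ^ 3 else 0| ≤ 1 / ε := by
    split_ifs with hl
    · refine le_trans ?_ h1
      rw [abs_div, abs_mul, abs_of_pos (pow_pos hN 3), div_le_div_iff₀ (pow_pos hN 3) hN]
      have := mul_le_mul (abs_le_regNorm (ε := ε) hi y) (abs_le_regNorm (ε := ε) hl y)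
        (abs_nonneg _) hN.le
      nlinarith
    · simpa using hε.le
  calc |quotDeriv S ε i l y| ≤ _ := abs_sub _ _
    _ ≤ 1 / ε + 1 / ε := add_le_add h2 h3
    _ = 2 / ε := by ring

/-- The pointwise form of `|∇|U||² ≤ |∇U|²`, weighted by the regularized norm. -/
lemma sum_quotDeriv_nonneg {E : Type*} [NormedAddCommGroup E] [InnerProductSpace ℝ E]
    (hε : 0 < ε) (y : Fin k → ℝ) (a : Fin k → E) :
    0 ≤ ∑ i ∈ S, ∑ l, quotDeriv S ε i l y * inner ℝ (a i) (a l) := by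
  have hN := regNorm_pos (S := S) hε y
  set N := regNorm S ε y with hNdef
  have e : ∑ i ∈ S, ∑ l, quotDeriv S ε i l y * inner ℝ (a i) (a l) =
      (N ^ 2 * (∑ i ∈ S, ‖a i‖ ^ 2) - ‖∑ i ∈ S, y i • a i‖ ^ 2) / N ^ 3 := by
    have h1 : ∀ i, ∑ l, quotDeriv S ε i l y * inner ℝ (a i) (a l) =
        ‖a i‖ ^ 2 / N - (∑ l ∈ S, y i * y l * inner ℝ (a i) (a l)) / N ^ 3 := by
      intro i
      simp only [quotDeriv, ← hNdef, sub_mul, ite_mul, zero_mul, Finset.sum_sub_distrib,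
        Finset.sum_ite_eq', Finset.mem_univ, if_true, Finset.sum_ite_mem, Finset.univ_inter,
        real_inner_self_eq_norm_sq, Finset.sum_div]
      congr 1
      · ring
      · exact Finset.sum_congr rfl fun l _ => by ring
    have h2 : ‖∑ i ∈ S, y i • a i‖ ^ 2 = ∑ i ∈ S, ∑ l ∈ S, y i * y l * inner ℝ (a i) (a l) := by
      rw [← real_inner_self_eq_norm_sq, sum_inner]
      refine Finset.sum_congr rfl fun i _ => ?_
      rw [inner_sum]
      refine Finset.sum_congr rfl fun l _ => ?_
      rw [real_inner_smul_left, real_inner_smul_right]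
      ring
    rw [h2, Finset.sum_congr rfl fun i _ => h1 i, Finset.sum_sub_distrib, ← Finset.sum_div,
      ← Finset.sum_div]
    field_simp
  rw [e]
  refine div_nonneg (sub_nonneg.2 ?_) (by positivity)
  have h3 : ‖∑ i ∈ S, y i • a i‖ ≤ ∑ i ∈ S, |y i| * ‖a i‖ :=
    (norm_sum_le _ _).trans (le_of_eq (Finset.sum_congr rfl fun i _ => by
      rw [norm_smul, Real.norm_eq_abs]))
  calc ‖∑ i ∈ S, y i • a i‖ ^ 2 ≤ (∑ i ∈ S, |y i| * ‖a i‖) ^ 2 := by gcongr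
    _ ≤ (∑ i ∈ S, |y i| ^ 2) * ∑ i ∈ S, ‖a i‖ ^ 2 := Finset.sum_mul_sq_le_sq_mul_sq _ _ _
    _ ≤ N ^ 2 * ∑ i ∈ S, ‖a i‖ ^ 2 := by
      refine mul_le_mul_of_nonneg_right ?_ (Finset.sum_nonneg fun _ _ => sq_nonneg _)
      rw [hNdef, regNorm_sq]
      simp only [sq_abs]
      linarith [sq_nonneg ε]

end RegularizedNorm

section Subharmonic

variable {d k : ℕ} {D : Opens (EuclideanSpace ℝ (Fin d))}
  [IsFiniteMeasure (volume.restrict (D : Set (EuclideanSpace ℝ (Fin d))))]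
  {u : Fin k → EuclideanSpace ℝ (Fin d) → ℝ} {S : Finset (Fin k)}

/-- The regularized norm is subharmonic: the harmonicity of `u_i` is tested with
`φ u_i / regNorm`, and the results are added up. -/
lemma integral_regNorm_mul_laplacian_nonneg (hu : ∀ i, MemH1 D (u i))
    (hharm : ∀ i ∈ S, IsHarmonicOn D {x | x ∈ D ∧ ∃ l ∈ S, u l x ≠ 0} (u i))
    {ε : ℝ} (hε : 0 < ε) (φ : TestFunction D ℝ ⊤) (hφ : ∀ x, 0 ≤ φ x) :
    0 ≤ ∫ x in D, regNorm S ε (fun l => u l x) * Δ (φ : EuclideanSpace ℝ (Fin d) → ℝ) x := by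
  set G := fun i => weakGradient D (u i) with hGdef
  have hG : ∀ i, HasH1Grad D (u i) (G i) := fun i => (hu i).hasH1Grad
  have hN : HasH1Grad D (fun x => regNorm S ε fun l => u l x) (fun x => ∑ l,
      (if l ∈ S then u l x / regNorm S ε (fun l => u l x) else 0) • G l x) := by
    refine HasH1Grad.comp (C := 1)
      (f := fun l y => if l ∈ S then y l / regNorm S ε y else 0) hG (hasFDerivAt_regNorm hε)
      (fun l => ?_) fun l y => ?_
    · by_cases hl : l ∈ S
      · simp only [if_pos hl]
        exact (continuous_apply l).div continuous_regNorm fun y => (regNorm_pos hε y).ne'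
      · simp only [if_neg hl]
        exact continuous_const
    · split_ifs with hl
      · rw [abs_div, abs_of_pos (regNorm_pos hε y), div_le_one (regNorm_pos hε y)]
        exact abs_le_regNorm hl y
      · simp
  have hQ : ∀ i ∈ S, HasH1Grad D (fun x => u i x / regNorm S ε fun l => u l x)
      (fun x => ∑ l, quotDeriv S ε i l (fun l => u l x) • G l x) := fun i hi =>
    HasH1Grad.comp (F := fun y => y i / regNorm S ε y) hG (hasFDerivAt_div_regNorm hε i)
      (continuous_quotDeriv hε i) (abs_quotDeriv_le hε hi)
  have htest : ∀ i ∈ S, ∫ x in D, inner ℝ (G i x)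
      (φ x • (∑ l, quotDeriv S ε i l (fun l => u l x) • G l x) +
        (u i x / regNorm S ε fun l => u l x) • ∇ φ x) = 0 := by
    intro i hi
    have hv := (hQ i hi).mul_testFunction φ
    rw [← (hharm i hi).2 _ ⟨hv.memH10, Eventually.of_forall fun x hx => ?_⟩]
    · refine integral_congr_ae ?_
      filter_upwards [hv.1.weakGradient_ae_eq] with x hx
      rw [hx]
    · by_cases hxD : x ∈ D
      · have : u i x = 0 := by
          by_contra h
          exact hx ⟨hxD, i, hi, h⟩
        simp [this]
      · simp [φ.eq_zero_of_notMem hxD]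
  rw [hN.integral_mul_laplacian, neg_nonneg]
  have hint : ∀ i ∈ S, Integrable (fun x => inner ℝ (G i x)
      (φ x • (∑ l, quotDeriv S ε i l (fun l => u l x) • G l x) +
        (u i x / regNorm S ε fun l => u l x) • ∇ φ x)) (volume.restrict D) := fun i hi =>
    integrable_inner_of_memLp (hG i).memLp_grad ((hQ i hi).mul_testFunction φ).1.memLp_grad
  calc ∫ x in D, inner ℝ (∑ l,
        (if l ∈ S then u l x / regNorm S ε (fun l => u l x) else 0) • G l x) (∇ φ x)
      ≤ ∫ x in D, ∑ i ∈ S, inner ℝ (G i x)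
          (φ x • (∑ l, quotDeriv S ε i l (fun l => u l x) • G l x) +
            (u i x / regNorm S ε fun l => u l x) • ∇ φ x) := by
        refine integral_mono (integrable_inner_of_memLp hN.memLp_grad (φ.memLp_gradient 2 _))
          (integrable_finsetSum _ hint) fun x => ?_
        have h1 := mul_nonneg (hφ x)
          (sum_quotDeriv_nonneg (S := S) hε (fun l => u l x) fun l => G l x)
        simp only [inner_add_right, real_inner_smul_right, inner_sum, sum_inner, ite_smul,
          zero_smul, Finset.sum_ite_mem, Finset.univ_inter, real_inner_smul_left,
          Finset.sum_add_distrib, ← Finset.mul_sum]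
        linarith
    _ = 0 := by
        rw [integral_finsetSum _ hint]
        exact Finset.sum_eq_zero htest

/-- If the functions `u_i`, `i ∈ S`, are harmonic on the set where one of them does not vanish,
then the Euclidean norm of `(u_i)_{i ∈ S}` is subharmonic. -/
lemma isDistribSubharmonic_sqrt (hu : ∀ i, MemH1 D (u i))
    (hharm : ∀ i ∈ S, IsHarmonicOn D {x | x ∈ D ∧ ∃ l ∈ S, u l x ≠ 0} (u i)) :
    MemLp (fun x => √(∑ l ∈ S, u l x ^ 2)) 2 (volume.restrict D) ∧
      IsDistribSubharmonic D fun x => √(∑ l ∈ S, u l x ^ 2) := by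
  have hm : MemLp (fun x => √(∑ l ∈ S, u l x ^ 2)) 2 (volume.restrict D) := by
    have hsum : MemLp (fun x => ∑ l ∈ S, |u l x|) 2 (volume.restrict D) :=
      memLp_finsetSum _ fun l _ => (hu l).1.abs
    refine hsum.mono ?_ (Eventually.of_forall fun x => ?_)
    · have h1 : AEStronglyMeasurable (fun x l => u l x) (volume.restrict D) :=
        (MemLp.of_eval (p := 2) fun l => (hu l).1).1
      have h2 : Continuous fun y : Fin k → ℝ => √(∑ l ∈ S, y l ^ 2) := by fun_prop
      exact h2.comp_aestronglyMeasurable h1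
    · have h0 : 0 ≤ ∑ l ∈ S, |u l x| := Finset.sum_nonneg fun _ _ => abs_nonneg _
      rw [Real.norm_of_nonneg (Real.sqrt_nonneg _), Real.norm_of_nonneg h0]
      refine Real.sqrt_le_iff.2 ⟨h0, ?_⟩
      simp only [← sq_abs (u _ x)]
      exact Finset.sum_sq_le_sq_sum_of_nonneg fun _ _ => abs_nonneg _
  refine ⟨hm, locallyIntegrableOn_of_locallyIntegrable_restrict (hm.locallyIntegrable one_le_two),
    fun φ hφ => ?_⟩
  have hΔ := memLp_laplacian φ
  have hΔ1 : Integrable (Δ (φ : EuclideanSpace ℝ (Fin d) → ℝ)) (volume.restrict D) :=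
    hΔ.integrable one_le_two
  have hI := integrable_mul_of_memLp hm hΔ
  -- replace the norm by its regularization, at the cost of a multiple of `ε`
  have key : ∀ ε : ℝ, 0 < ε → 0 ≤ (∫ x in D, √(∑ l ∈ S, u l x ^ 2) *
      Δ (φ : EuclideanSpace ℝ (Fin d) → ℝ) x) +
      ε * ∫ x in D, |Δ (φ : EuclideanSpace ℝ (Fin d) → ℝ) x| := by
    intro ε hε
    refine (integral_regNorm_mul_laplacian_nonneg hu hharm hε φ hφ).trans ?_
    rw [← integral_const_mul, ← integral_add hI (hΔ1.abs.const_mul ε)]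
    have hreg : MemLp (fun x => regNorm S ε fun l => u l x) 2 (volume.restrict D) := by
      refine (hm.add (memLp_const ε)).mono ?_ (Eventually.of_forall fun x => ?_)
      · exact continuous_regNorm.comp_aestronglyMeasurable
          (MemLp.of_eval (p := 2) fun l => (hu l).1).1
      · have h1 := abs_le.1 (abs_regNorm_sub_le (S := S) hε fun l => u l x)
        rw [Real.norm_of_nonneg (regNorm_pos hε _).le, Pi.add_apply,
          Real.norm_of_nonneg (by positivity)]
        linarith
    refine integral_mono (integrable_mul_of_memLp hreg hΔ) (hI.add (hΔ1.abs.const_mul ε))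
      fun x => ?_
    have h1 := mul_le_mul_of_nonneg_right (abs_regNorm_sub_le (S := S) hε fun l => u l x)
      (abs_nonneg (Δ (φ : EuclideanSpace ℝ (Fin d) → ℝ) x))
    rw [← abs_mul] at h1
    have h2 := (le_abs_self _).trans h1
    simp only
    linarith
  have hlim : Tendsto (fun ε : ℝ => (∫ x in D, √(∑ l ∈ S, u l x ^ 2) *
      Δ (φ : EuclideanSpace ℝ (Fin d) → ℝ) x) +
      ε * ∫ x in D, |Δ (φ : EuclideanSpace ℝ (Fin d) → ℝ) x|) (𝓝[>] 0)
      (𝓝 (∫ x in D, √(∑ l ∈ S, u l x ^ 2) * Δ (φ : EuclideanSpace ℝ (Fin d) → ℝ) x)) := by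
    have : Continuous fun ε : ℝ => (∫ x in D, √(∑ l ∈ S, u l x ^ 2) *
      Δ (φ : EuclideanSpace ℝ (Fin d) → ℝ) x) +
      ε * ∫ x in D, |Δ (φ : EuclideanSpace ℝ (Fin d) → ℝ) x| := by fun_prop
    simpa using (this.tendsto 0).mono_left nhdsWithin_le_nhds
  exact ge_of_tendsto hlim (by filter_upwards [self_mem_nhdsWithin] with ε hε using key ε hε)

end Subharmonic

/-! ### Compactness in `H¹₀` -/

section WeakCompactness

/-- Bounded sequences in a separable Hilbert space have weakly convergent subsequences. -/
lemma exists_weak_limit {H : Type*} [NormedAddCommGroup H] [InnerProductSpace ℝ H]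
    [CompleteSpace H] [SeparableSpace H] {x : ℕ → H} {C : ℝ} (hx : ∀ n, ‖x n‖ ≤ C) :
    ∃ (s : ℕ → ℕ) (x₀ : H), StrictMono s ∧
      ∀ y, Tendsto (fun n => inner ℝ (x (s n)) y) atTop (𝓝 (inner ℝ x₀ y)) := by
  have hmem : ∀ n, StrongDual.toWeakDual (InnerProductSpace.toDual ℝ H (x n)) ∈
      WeakDual.toStrongDual ⁻¹' Metric.closedBall (0 : StrongDual ℝ H) C := by
    intro n
    change InnerProductSpace.toDual ℝ H (x n) ∈ Metric.closedBall (0 : StrongDual ℝ H) C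
    simpa using hx n
  obtain ⟨f, -, s, hs, hlim⟩ := WeakDual.isSeqCompact_closedBall ℝ H 0 C hmem
  refine ⟨s, (InnerProductSpace.toDual ℝ H).symm (WeakDual.toStrongDual f), hs, fun y => ?_⟩
  have h1 := ((WeakDual.eval_continuous y).tendsto f).comp hlim
  rw [InnerProductSpace.toDual_symm_apply]
  exact h1

end WeakCompactness

section Translation

variable {d : ℕ} {D : Opens (EuclideanSpace ℝ (Fin d))}

lemma eLpNorm_translate {F : Type*} [NormedAddCommGroup F] {f : EuclideanSpace ℝ (Fin d) → F}
    (hf : AEStronglyMeasurable f volume) (t : EuclideanSpace ℝ (Fin d)) :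
    eLpNorm (fun x => f (x - t)) 2 volume = eLpNorm f 2 volume :=
  eLpNorm_comp_measurePreserving (f := fun x => x - t) hf (measurePreserving_sub_right volume t)

lemma eLpNorm_comp_sub_left {F : Type*} [NormedAddCommGroup F]
    {f : EuclideanSpace ℝ (Fin d) → F} (hf : AEStronglyMeasurable f volume)
    (x : EuclideanSpace ℝ (Fin d)) :
    eLpNorm (fun t => f (x - t)) 2 volume = eLpNorm f 2 volume :=
  eLpNorm_comp_measurePreserving (f := fun t => x - t) hf
    (Measure.measurePreserving_sub_left volume x)

lemma memLp_comp_sub_left {F : Type*} [NormedAddCommGroup F]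
    {f : EuclideanSpace ℝ (Fin d) → F} (hf : MemLp f 2 volume)
    (x : EuclideanSpace ℝ (Fin d)) : MemLp (fun t => f (x - t)) 2 volume :=
  hf.comp_measurePreserving (f := fun t => x - t) (Measure.measurePreserving_sub_left volume x)

/-- Translation by `t` moves a test function by at most `‖t‖` times the norm of its gradient. -/
lemma eLpNorm_translate_sub_le (φ : TestFunction D ℝ ⊤) (t : EuclideanSpace ℝ (Fin d)) :
    eLpNorm (fun x => φ (x - t) - φ x) 2 volume ≤ ‖t‖ₑ * eLpNorm (∇ φ) 2 volume := by
  set ν : Measure ℝ := volume.restrict (Ioc 0 1) with hν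
  have : IsProbabilityMeasure ν := ⟨by simp [hν]⟩
  have hcont : Continuous fun p : EuclideanSpace ℝ (Fin d) × ℝ => fderiv ℝ φ (p.1 - p.2 • t) t :=
    (φ.continuous_fderiv_apply t).comp (by fun_prop)
  refine eLpNorm_two_le_of_le_average (ν := ν)
    (b := fun x s => fderiv ℝ φ (x - s • t) t)
    hcont.aestronglyMeasurable (Eventually.of_forall fun x => ?_) (Eventually.of_forall fun s => ?_)
  · have hder : ∀ s : ℝ, HasDerivAt (fun s : ℝ => φ (x - s • t)) (-fderiv ℝ φ (x - s • t) t) s := by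
      intro s
      have h1 : HasDerivAt (fun s : ℝ => x - s • t) (-t) s := by
        simpa using ((hasDerivAt_id s).smul_const t).const_sub x
      have h3 := (φ.differentiable (x - s • t)).hasFDerivAt.comp_hasDerivAt s h1
      rw [map_neg] at h3
      exact h3
    have hc : Continuous fun s : ℝ => -fderiv ℝ φ (x - s • t) t :=
      ((φ.continuous_fderiv_apply t).comp (by fun_prop)).neg
    have h2 := intervalIntegral.integral_eq_sub_of_hasDerivAt (fun s _ => hder s)
      (hc.intervalIntegrable 0 1)
    rw [intervalIntegral.integral_of_le zero_le_one] at h2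
    simp only [one_smul, zero_smul, sub_zero] at h2
    rw [← h2]
    refine (enorm_integral_le_lintegral_enorm _).trans (le_of_eq ?_)
    simp only [enorm_neg, hν]
  · rw [eLpNorm_translate (f := fun x => fderiv ℝ φ x t)
      (φ.continuous_fderiv_apply t).aestronglyMeasurable (s • t), ← ofReal_norm]
    refine eLpNorm_le_mul_eLpNorm_of_ae_le_mul (Eventually.of_forall fun x => ?_) 2
    rw [norm_gradient, mul_comm]
    exact (fderiv ℝ φ x).le_opNorm t

/-- The Poincaré inequality: a translation by more than the diameter of `D` separates the supports
of a test function and its translate. -/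
lemma exists_poincare [NeZero d]
    (hD : Bornology.IsBounded (D : Set (EuclideanSpace ℝ (Fin d)))) :
    ∃ t : EuclideanSpace ℝ (Fin d), ∀ φ : TestFunction D ℝ ⊤,
      eLpNorm φ 2 volume ≤ ‖t‖ₑ * eLpNorm (∇ φ) 2 volume := by
  obtain ⟨R, hR⟩ := hD.subset_ball 0
  obtain ⟨t, ht⟩ := NormedSpace.exists_lt_norm ℝ (EuclideanSpace ℝ (Fin d)) (2 * R)
  refine ⟨t, fun φ => le_trans (eLpNorm_mono fun x => ?_) (eLpNorm_translate_sub_le φ t)⟩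
  by_cases hx : x ∈ D
  · have hxt : x - t ∉ D := by
      intro h
      have h1 : ‖x‖ < R := by simpa using hR hx
      have h2 : ‖x - t‖ < R := by simpa using hR h
      have h3 : ‖t‖ ≤ ‖x‖ + ‖x - t‖ := by
        calc ‖t‖ = ‖x - (x - t)‖ := by simp
          _ ≤ _ := norm_sub_le _ _
      linarith
    simp [φ.eq_zero_of_notMem hxt]
  · simp [φ.eq_zero_of_notMem hx]

lemma eLpNorm_restrict_eq {F : Type*} [NormedAddCommGroup F] {f : EuclideanSpace ℝ (Fin d) → F}
    (hf : ∀ x ∉ D, f x = 0) : eLpNorm f 2 (volume.restrict D) = eLpNorm f 2 volume := by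
  rw [← eLpNorm_indicator_eq_eLpNorm_restrict D.isOpen.measurableSet]
  congr 1
  funext x
  by_cases hx : x ∈ (D : Set (EuclideanSpace ℝ (Fin d)))
  · simp [indicator_of_mem hx]
  · rw [indicator_of_notMem hx, hf x hx]

/-- Weak convergence in `L²(D)` implies strong convergence of the mollifications: they converge
pointwise, and they are uniformly bounded on the set `D` of finite measure. -/
lemma tendsto_eLpNorm_mollify_sub_mollify
    [IsFiniteMeasure (volume.restrict (D : Set (EuclideanSpace ℝ (Fin d))))]
    {φ : ℕ → TestFunction D ℝ ⊤} {V : EuclideanSpace ℝ (Fin d) → ℝ} {M : ℝ≥0∞} (hM : M ≠ ∞)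
    (hφ : ∀ n, eLpNorm (φ n) 2 volume ≤ M) (hVm : MemLp V 2 volume) (hV0 : ∀ x ∉ D, V x = 0)
    (hw : ∀ h, MemLp h 2 (volume.restrict D) →
      Tendsto (fun n => ∫ x in D, φ n x * h x) atTop (𝓝 (∫ x in D, V x * h x)))
    (ρ : ContDiffBump (0 : EuclideanSpace ℝ (Fin d))) :
    Tendsto (fun n => eLpNorm (fun x => mollify ρ V x - mollify ρ (φ n) x) 2 (volume.restrict D))
      atTop (𝓝 0) := by
  set μ := volume.restrict (D : Set (EuclideanSpace ℝ (Fin d))) with hμ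
  have hVl := hVm.locallyIntegrable one_le_two
  have hφl : ∀ n, LocallyIntegrable (φ n) volume := fun n =>
    ((φ n).memLp 2 _).locallyIntegrable one_le_two
  have hrep : ∀ (f : EuclideanSpace ℝ (Fin d) → ℝ), (∀ x ∉ D, f x = 0) → ∀ x,
      mollify ρ f x = ∫ t in D, f t * ρ.normed volume (x - t) := by
    intro f hf x
    rw [mollify_eq_integral, setIntegral_eq_integral_of_forall_compl_eq_zero]
    · exact integral_congr_ae (Eventually.of_forall fun t => mul_comm _ _)
    · intro t ht
      rw [hf t ht, zero_mul]
  have hρm : MemLp (ρ.normed volume) 2 (volume : Measure (EuclideanSpace ℝ (Fin d))) :=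
    ρ.continuous_normed.memLp_of_hasCompactSupport ρ.hasCompactSupport_normed
  have hρx : ∀ x, MemLp (fun t => ρ.normed volume (x - t)) 2 μ := fun x =>
    (memLp_comp_sub_left hρm x).restrict _
  have hρn : ∀ x, eLpNorm (fun t => ρ.normed volume (x - t)) 2 μ ≤
      eLpNorm (ρ.normed volume) 2 (volume : Measure (EuclideanSpace ℝ (Fin d))) := fun x =>
    (eLpNorm_mono_measure _ Measure.restrict_le_self).trans
      (eLpNorm_comp_sub_left hρm.1 x).le
  have hφ0 : ∀ n, ∀ x ∉ D, φ n x = 0 := fun n x hx => (φ n).eq_zero_of_notMem hx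
  have hdiff : ∀ n x, mollify ρ V x - mollify ρ (φ n) x =
      ∫ t in D, (V t - φ n t) * ρ.normed volume (x - t) := by
    intro n x
    rw [hrep V hV0, hrep (φ n) (hφ0 n)]
    simp only [sub_mul]
    exact (integral_sub (integrable_mul_of_memLp (hVm.restrict _) (hρx x))
      (integrable_mul_of_memLp ((φ n).memLp 2 _) (hρx x))).symm
  have hpt : ∀ x, Tendsto (fun n => mollify ρ V x - mollify ρ (φ n) x) atTop (𝓝 0) := by
    intro x
    have h1 := hw _ (hρx x)
    rw [← hrep V hV0] at h1
    have h3 := h1.const_sub (mollify ρ V x)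
    rw [sub_self] at h3
    refine h3.congr fun n => ?_
    rw [hrep (φ n) (hφ0 n)]
  set B : ℝ≥0∞ := (eLpNorm V 2 volume + M) *
    eLpNorm (ρ.normed volume) 2 (volume : Measure (EuclideanSpace ℝ (Fin d))) with hB
  have hBt : B ≠ ∞ := ENNReal.mul_ne_top (ENNReal.add_ne_top.2 ⟨hVm.2.ne, hM⟩) hρm.2.ne
  have hbound : ∀ n x, ‖mollify ρ V x - mollify ρ (φ n) x‖ₑ ≤ B := by
    intro n x
    have hsub : MemLp (fun t => V t - φ n t) 2 μ := (hVm.restrict _).sub ((φ n).memLp 2 _)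
    have h1 := abs_integral_inner_le (μ := μ) (hρx x) hsub
    have h2 : eLpNorm (fun t => V t - φ n t) 2 μ ≤ eLpNorm V 2 volume + M := by
      refine (eLpNorm_mono_measure _ Measure.restrict_le_self).trans ?_
      exact (eLpNorm_sub_le hVm.1 ((φ n).memLp 2 _).1 one_le_two).trans (by gcongr; exact hφ n)
    rw [hdiff, ← ofReal_norm, Real.norm_eq_abs]
    refine (ENNReal.ofReal_le_ofReal h1).trans ?_
    rw [← ENNReal.toReal_mul, ENNReal.ofReal_toReal (ENNReal.mul_ne_top (hρx x).2.ne hsub.2.ne),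
      mul_comm]
    exact mul_le_mul' h2 (hρn x)
  have hsq : Tendsto (fun n => eLpNorm (fun x => mollify ρ V x - mollify ρ (φ n) x) 2 μ ^ 2)
      atTop (𝓝 0) := by
    simp only [eLpNorm_two_sq_eq_lintegral]
    have h0 : (0 : ℝ≥0∞) = ∫⁻ _, 0 ∂μ := by simp
    rw [h0]
    refine tendsto_lintegral_of_dominated_convergence (fun _ => B ^ 2) (fun n => ?_)
      (fun n => Eventually.of_forall fun x => ?_) ?_ (Eventually.of_forall fun x => ?_)
    · exact (((continuous_mollify ρ hVl).sub
        (continuous_mollify ρ (hφl n))).measurable.enorm).pow_const 2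
    · exact ENNReal.pow_le_pow_left (hbound n x)
    · rw [lintegral_const]
      exact ENNReal.mul_ne_top (ENNReal.pow_ne_top hBt) (measure_ne_top μ univ)
    · have := ((ENNReal.continuous_pow 2).tendsto _).comp
        ((continuous_enorm.tendsto (0 : ℝ)).comp (hpt x))
      simpa [Function.comp_def] using this
  have hroot := ((ENNReal.continuous_rpow_const (y := 1 / 2)).tendsto 0).comp hsq
  simp only [ENNReal.zero_rpow_of_pos (by norm_num : (0 : ℝ) < 1 / 2)] at hroot
  refine hroot.congr fun n => ?_
  rw [Function.comp_apply, ← ENNReal.rpow_natCast, ← ENNReal.rpow_mul]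
  norm_num

/-- **Rellich's theorem**: a weakly convergent sequence of test functions with bounded gradients
converges strongly in `L²`. Weak convergence gives strong convergence of the mollifications, which
differ from the functions by at most the radius times the norm of the gradient. -/
lemma tendsto_eLpNorm_sub_of_weak
    [IsFiniteMeasure (volume.restrict (D : Set (EuclideanSpace ℝ (Fin d))))]
    {φ : ℕ → TestFunction D ℝ ⊤} {v : EuclideanSpace ℝ (Fin d) → ℝ} {M : ℝ≥0∞} (hM : M ≠ ∞)
    (hφ : ∀ n, eLpNorm (φ n) 2 volume ≤ M) (hG : ∀ n, eLpNorm (∇ (φ n)) 2 volume ≤ M)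
    (hv : MemLp v 2 (volume.restrict D))
    (hw : ∀ h, MemLp h 2 (volume.restrict D) →
      Tendsto (fun n => ∫ x in D, φ n x * h x) atTop (𝓝 (∫ x in D, v x * h x))) :
    Tendsto (fun n => eLpNorm (fun x => v x - φ n x) 2 (volume.restrict D)) atTop (𝓝 0) := by
  set μ := volume.restrict (D : Set (EuclideanSpace ℝ (Fin d))) with hμ
  set V : EuclideanSpace ℝ (Fin d) → ℝ := (D : Set (EuclideanSpace ℝ (Fin d))).indicator v with hV
  have hVm : MemLp V 2 volume := (memLp_indicator_iff_restrict D.isOpen.measurableSet).2 hv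
  have hVv : V =ᵐ[μ] v := indicator_ae_eq_restrict D.isOpen.measurableSet
  have hwV : ∀ h, MemLp h 2 μ →
      Tendsto (fun n => ∫ x, φ n x * h x ∂μ) atTop (𝓝 (∫ x, V x * h x ∂μ)) := by
    intro h hh
    have e : ∫ x, V x * h x ∂μ = ∫ x, v x * h x ∂μ :=
      integral_congr_ae (by filter_upwards [hVv] with x hx; rw [hx])
    rw [e]
    exact hw h hh
  have hmoll := tendsto_eLpNorm_mollify_sub_mollify hM hφ hVm
    (fun x hx => indicator_of_notMem hx v) hwV
  rw [ENNReal.tendsto_nhds_zero]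
  intro ε hε
  have hε3 : 0 < ε / 3 := ENNReal.div_pos hε.ne' (by simp)
  let ρ : ℕ → ContDiffBump (0 : EuclideanSpace ℝ (Fin d)) := fun n =>
    ⟨1 / (n + 1 : ℝ) / 2, 1 / (n + 1 : ℝ), half_pos (by positivity), half_lt_self (by positivity)⟩
  have hρ : Tendsto (fun n => (ρ n).rOut) atTop (𝓝 0) := tendsto_one_div_add_atTop_nhds_zero_nat
  have hρM : Tendsto (fun n => ENNReal.ofReal (ρ n).rOut * M) atTop (𝓝 0) := by
    simpa using ENNReal.Tendsto.mul_const (ENNReal.tendsto_ofReal hρ) (Or.inr hM)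
  obtain ⟨m, hm1, hm2⟩ := ((ENNReal.tendsto_nhds_zero.1 hρM (ε / 3) hε3).and
    (ENNReal.tendsto_nhds_zero.1 (tendsto_eLpNorm_mollify_sub hρ hVm) (ε / 3) hε3)).exists
  filter_upwards [ENNReal.tendsto_nhds_zero.1 (hmoll (ρ m)) (ε / 3) hε3] with n hn
  have hφm := ((φ n).memLp 2 (volume : Measure (EuclideanSpace ℝ (Fin d))))
  have h3 : eLpNorm (fun x => mollify (ρ m) (φ n) x - φ n x) 2 volume ≤ ε / 3 := by
    refine (eLpNorm_mollify_sub_le (ρ m) hφm fun t ht => ?_).trans hm1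
    refine (eLpNorm_translate_sub_le (φ n) t).trans ?_
    rw [← ofReal_norm]
    exact mul_le_mul' (ENNReal.ofReal_le_ofReal ht.le) (hG n)
  have hmV : AEStronglyMeasurable (fun x => mollify (ρ m) V x) μ :=
    (continuous_mollify _ (hVm.locallyIntegrable one_le_two)).aestronglyMeasurable
  have hmφ : AEStronglyMeasurable (fun x => mollify (ρ m) (φ n) x) μ :=
    (continuous_mollify _ (hφm.locallyIntegrable one_le_two)).aestronglyMeasurable
  have hφμ : AEStronglyMeasurable (φ n) μ := (φ n).continuous.aestronglyMeasurable
  calc eLpNorm (fun x => v x - φ n x) 2 μ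
      = eLpNorm ((fun x => (mollify (ρ m) V x - mollify (ρ m) (φ n) x) +
          (mollify (ρ m) (φ n) x - φ n x)) - fun x => (mollify (ρ m) V x - V x)) 2 μ := by
        refine eLpNorm_congr_ae ?_
        filter_upwards [hVv] with x hx
        simp only [Pi.sub_apply, ← hx]
        ring
    _ ≤ eLpNorm (fun x => (mollify (ρ m) V x - mollify (ρ m) (φ n) x) +
          (mollify (ρ m) (φ n) x - φ n x)) 2 μ +
          eLpNorm (fun x => (mollify (ρ m) V x - V x)) 2 μ :=
        eLpNorm_sub_le ((hmV.sub hmφ).add (hmφ.sub hφμ)) (hmV.sub hVm.1.restrict) one_le_two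
    _ ≤ eLpNorm (fun x => (mollify (ρ m) V x - mollify (ρ m) (φ n) x)) 2 μ +
          eLpNorm (fun x => (mollify (ρ m) (φ n) x - φ n x)) 2 μ +
          eLpNorm (fun x => (mollify (ρ m) V x - V x)) 2 μ := by
        gcongr
        exact eLpNorm_add_le (hmV.sub hmφ) (hmφ.sub hφμ) one_le_two
    _ ≤ ε / 3 + ε / 3 + ε / 3 := by
        refine add_le_add (add_le_add hn ?_) ?_
        · exact (eLpNorm_mono_measure _ Measure.restrict_le_self).trans h3
        · exact (eLpNorm_mono_measure _ Measure.restrict_le_self).trans hm2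
    _ = ε := ENNReal.add_thirds ε

end Translation

section WeakLimit

variable {d : ℕ} {D : Opens (EuclideanSpace ℝ (Fin d))}

/-- The Hilbert space `L²(D) × L²(D, ℝ^d)`. -/
abbrev PairL2 (D : Opens (EuclideanSpace ℝ (Fin d))) : Type :=
  WithLp 2 (Lp ℝ 2 (volume.restrict (D : Set (EuclideanSpace ℝ (Fin d)))) ×
    Lp (EuclideanSpace ℝ (Fin d)) 2 (volume.restrict (D : Set (EuclideanSpace ℝ (Fin d)))))

lemma separableSpace_pairL2 : SeparableSpace (PairL2 D) := by
  have : Fact ((2 : ℝ≥0∞) ≠ ∞) := ⟨ENNReal.ofNat_ne_top⟩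
  have h1 : SecondCountableTopology
      (Lp ℝ 2 (volume.restrict (D : Set (EuclideanSpace ℝ (Fin d))))) := inferInstance
  have h2 : SecondCountableTopology (Lp (EuclideanSpace ℝ (Fin d)) 2
      (volume.restrict (D : Set (EuclideanSpace ℝ (Fin d))))) := inferInstance
  have h3 : SecondCountableTopology (PairL2 D) := WithLp.secondCountableTopology 2 _ _
  infer_instance

/-- A test function and its gradient, as an element of `L² × L²`. -/
noncomputable def _root_.TestFunction.toL2 (φ : TestFunction D ℝ ⊤) : PairL2 D :=
  WithLp.toLp 2 ((φ.memLp 2 _).toLp, (φ.memLp_gradient 2 _).toLp)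

/-- The subspace of `L² × L²` formed by the test functions and their gradients. -/
noncomputable def testSubmodule (D : Opens (EuclideanSpace ℝ (Fin d))) :
    Submodule ℝ (PairL2 D) where
  carrier := range TestFunction.toL2
  zero_mem' := by
    refine ⟨0, ?_⟩
    have h0 : ∀ x, ∇ ((0 : TestFunction D ℝ ⊤) : EuclideanSpace ℝ (Fin d) → ℝ) x = 0 :=
      fun x => by simpa using TestFunction.gradient_smul 0 (0 : TestFunction D ℝ ⊤) x
    refine (WithLp.ext_iff 2).2 (Prod.ext ?_ ?_)
    · rfl
    · exact (MemLp.toLp_eq_toLp_iff ((0 : TestFunction D ℝ ⊤).memLp_gradient 2 _) MemLp.zero).2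
        (Eventually.of_forall h0)
  add_mem' := by
    rintro _ _ ⟨φ, rfl⟩ ⟨ψ, rfl⟩
    refine ⟨φ + ψ, (WithLp.ext_iff 2).2 (Prod.ext ?_ ?_)⟩
    · rfl
    · refine ((MemLp.toLp_eq_toLp_iff ((φ + ψ).memLp_gradient 2 _)
        ((φ.memLp_gradient 2 _).add (ψ.memLp_gradient 2 _))).2
        (Eventually.of_forall fun x => ?_))
      exact TestFunction.gradient_add φ ψ x
  smul_mem' := by
    rintro c _ ⟨φ, rfl⟩
    refine ⟨c • φ, (WithLp.ext_iff 2).2 (Prod.ext ?_ ?_)⟩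
    · rfl
    · refine ((MemLp.toLp_eq_toLp_iff ((c • φ).memLp_gradient 2 _)
        ((φ.memLp_gradient 2 _).const_smul c)).2
        (Eventually.of_forall fun x => ?_))
      exact TestFunction.gradient_smul c φ x

/-- The closure of the test functions in `L² × L²` consists of `H¹₀` functions. -/
lemma hasH10Grad_of_mem_closure {p : PairL2 D}
    (hp : p ∈ (testSubmodule D).topologicalClosure) : HasH10Grad D p.fst p.snd := by
  obtain ⟨x, hx, hlim⟩ := mem_closure_iff_seq_limit.1 hp
  choose φ hφ using hx
  have hc := (WithLp.prod_continuous_ofLp 2 _ _).tendsto p |>.comp hlim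
  have h1 := (continuous_fst.tendsto _).comp hc
  have h2 := (continuous_snd.tendsto _).comp hc
  rw [tendsto_iff_edist_tendsto_0] at h1 h2
  refine .of_tendsto (l := atTop) (φ := φ) (Lp.memLp _) (Lp.memLp _) (h1.congr fun n => ?_)
    (h2.congr fun n => ?_)
  · rw [edist_comm, Lp.edist_def]
    refine eLpNorm_congr_ae ?_
    simp only [Function.comp_apply, ← hφ n]
    filter_upwards [((φ n).memLp 2 _).coeFn_toLp] with y hy
    simp only [Pi.sub_apply]
    rw [← hy]
    rfl
  · rw [edist_comm, Lp.edist_def]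
    refine eLpNorm_congr_ae ?_
    simp only [Function.comp_apply, ← hφ n]
    filter_upwards [((φ n).memLp_gradient 2 _).coeFn_toLp] with y hy
    simp only [Pi.sub_apply]
    rw [← hy]
    rfl

lemma inner_pairL2 (p : PairL2 D) {f : EuclideanSpace ℝ (Fin d) → ℝ}
    {F : EuclideanSpace ℝ (Fin d) → EuclideanSpace ℝ (Fin d)}
    (hf : MemLp f 2 (volume.restrict D)) (hF : MemLp F 2 (volume.restrict D)) :
    inner ℝ p (WithLp.toLp 2 (hf.toLp, hF.toLp) : PairL2 D) =
      (∫ x in D, p.fst x * f x) + ∫ x in D, inner ℝ (p.snd x) (F x) := by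
  have h1 := inner_toLp (Lp.memLp p.fst) hf
  have h2 := inner_toLp (Lp.memLp p.snd) hF
  rw [Lp.toLp_coeFn] at h1 h2
  rw [WithLp.prod_inner_apply]
  refine congrArg₂ _ (h1.trans ?_) h2
  simp [mul_comm]

lemma inner_toL2 (φ : TestFunction D ℝ ⊤) {f : EuclideanSpace ℝ (Fin d) → ℝ}
    {F : EuclideanSpace ℝ (Fin d) → EuclideanSpace ℝ (Fin d)}
    (hf : MemLp f 2 (volume.restrict D)) (hF : MemLp F 2 (volume.restrict D)) :
    inner ℝ φ.toL2 (WithLp.toLp 2 (hf.toLp, hF.toLp) : PairL2 D) =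
      (∫ x in D, φ x * f x) + ∫ x in D, inner ℝ (∇ φ x) (F x) := by
  rw [WithLp.prod_inner_apply]
  refine congrArg₂ _ ((inner_toLp (φ.memLp 2 _) hf).trans ?_)
    (inner_toLp (φ.memLp_gradient 2 _) hF)
  simp [mul_comm]

variable [NeZero d]

/-- Test functions with bounded gradients have a subsequence that converges almost everywhere,
with gradients converging weakly, to an `H¹₀` function. -/
lemma exists_subseq_testFunction (hD : Bornology.IsBounded (D : Set (EuclideanSpace ℝ (Fin d))))
    {φ : ℕ → TestFunction D ℝ ⊤} {M : ℝ≥0∞} (hM : M ≠ ∞)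
    (hG : ∀ n, eLpNorm (∇ (φ n)) 2 (volume.restrict D) ≤ M) :
    ∃ (s : ℕ → ℕ) (v : EuclideanSpace ℝ (Fin d) → ℝ)
      (G : EuclideanSpace ℝ (Fin d) → EuclideanSpace ℝ (Fin d)), StrictMono s ∧
      HasH10Grad D v G ∧
      (∀ᵐ x ∂volume.restrict (D : Set (EuclideanSpace ℝ (Fin d))),
        Tendsto (fun n => φ (s n) x) atTop (𝓝 (v x))) ∧
      ∀ h, MemLp h 2 (volume.restrict (D : Set (EuclideanSpace ℝ (Fin d)))) →
        Tendsto (fun n => ∫ x in D, inner ℝ (∇ (φ (s n)) x) (h x)) atTop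
          (𝓝 (∫ x in D, inner ℝ (G x) (h x))) := by
  have : IsFiniteMeasure (volume.restrict (D : Set (EuclideanSpace ℝ (Fin d)))) :=
    ⟨by rw [Measure.restrict_apply_univ]; exact hD.measure_lt_top⟩
  set μ := volume.restrict (D : Set (EuclideanSpace ℝ (Fin d))) with hμ
  have hGv : ∀ n, eLpNorm (∇ (φ n)) 2 volume ≤ M := fun n => by
    rw [← eLpNorm_restrict_eq fun x hx => (φ n).gradient_eq_zero_of_notMem hx]
    exact hG n
  obtain ⟨t, ht⟩ := exists_poincare hD
  set M' : ℝ≥0∞ := max M (‖t‖ₑ * M) with hM'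
  have hM't : M' ≠ ∞ := by
    simp [hM', hM, ENNReal.mul_eq_top]
  have hφM : ∀ n, eLpNorm (φ n) 2 volume ≤ M' := fun n =>
    (ht (φ n)).trans ((mul_le_mul_right (hGv n) _).trans (le_max_right _ _))
  have hGM : ∀ n, eLpNorm (∇ (φ n)) 2 volume ≤ M' := fun n => (hGv n).trans (le_max_left _ _)
  have hbound : ∀ n, ‖(φ n).toL2‖ ≤ M'.toReal + M'.toReal := by
    intro n
    have hle : ∀ {F : Type} [NormedAddCommGroup F] {f : EuclideanSpace ℝ (Fin d) → F}
        (hf : MemLp f 2 μ), eLpNorm f 2 volume ≤ M' → ‖hf.toLp‖ ≤ M'.toReal := by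
      intro F _ f hf hfM
      rw [Lp.norm_toLp]
      exact ENNReal.toReal_mono hM't
        ((eLpNorm_mono_measure _ Measure.restrict_le_self).trans hfM)
    have h1 := hle ((φ n).memLp 2 μ) (hφM n)
    have h2 := hle ((φ n).memLp_gradient 2 μ) (hGM n)
    have h3 := WithLp.prod_norm_sq_eq_of_L2 (φ n).toL2
    change _ = ‖((φ n).memLp 2 μ).toLp‖ ^ 2 + ‖((φ n).memLp_gradient 2 μ).toLp‖ ^ 2 at h3
    have h4 : 0 ≤ M'.toReal := ENNReal.toReal_nonneg
    refine abs_le_of_sq_le_sq' ?_ (by positivity) |>.2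
    rw [h3]
    nlinarith [norm_nonneg ((φ n).memLp 2 μ).toLp, norm_nonneg ((φ n).memLp_gradient 2 μ).toLp]
  have := separableSpace_pairL2 (D := D)
  obtain ⟨s, p, hs, hweak⟩ := exists_weak_limit hbound
  -- closed subspaces are weakly closed
  have hpmem : p ∈ (testSubmodule D).topologicalClosure := by
    rw [← Submodule.orthogonal_orthogonal_eq_closure, Submodule.mem_orthogonal']
    intro y hy
    refine tendsto_nhds_unique (hweak y) (tendsto_const_nhds.congr fun n => ?_)
    exact ((Submodule.mem_orthogonal _ y).1 hy _ ⟨φ (s n), rfl⟩).symm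
  have hp := hasH10Grad_of_mem_closure hpmem
  have hw1 : ∀ h, MemLp h 2 μ →
      Tendsto (fun n => ∫ x, φ (s n) x * h x ∂μ) atTop (𝓝 (∫ x, p.fst x * h x ∂μ)) := by
    intro h hh
    have h0 : MemLp (fun _ : EuclideanSpace ℝ (Fin d) => (0 : EuclideanSpace ℝ (Fin d))) 2 μ :=
      MemLp.zero'
    have h1 := hweak (WithLp.toLp 2 (hh.toLp, h0.toLp))
    rw [inner_pairL2 p hh h0] at h1
    simp only [inner_toL2 _ hh h0, inner_zero_right, integral_zero, add_zero] at h1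
    exact h1
  have hw2 : ∀ h, MemLp h 2 μ → Tendsto (fun n => ∫ x, inner ℝ (∇ (φ (s n)) x) (h x) ∂μ) atTop
      (𝓝 (∫ x, inner ℝ (p.snd x) (h x) ∂μ)) := by
    intro h hh
    have h0 : MemLp (fun _ : EuclideanSpace ℝ (Fin d) => (0 : ℝ)) 2 μ := MemLp.zero'
    have h1 := hweak (WithLp.toLp 2 (h0.toLp, hh.toLp))
    rw [inner_pairL2 p h0 hh] at h1
    simp only [inner_toL2 _ h0 hh, mul_zero, integral_zero, zero_add] at h1
    exact h1
  have hstrong := tendsto_eLpNorm_sub_of_weak hM't (fun n => hφM (s n)) (fun n => hGM (s n))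
    hp.1.memLp hw1
  have hmeas : TendstoInMeasure μ (fun n x => φ (s n) x) atTop p.fst := by
    refine tendstoInMeasure_of_tendsto_eLpNorm two_ne_zero
      (fun n => ((φ (s n)).memLp 2 μ).1) hp.1.memLp.1 (hstrong.congr fun n => ?_)
    rw [eLpNorm_sub_comm]
    rfl
  obtain ⟨s', hs', hae⟩ := hmeas.exists_seq_tendsto_ae
  exact ⟨s ∘ s', p.fst, p.snd, hs.comp hs', hp, hae,
    fun h hh => (hw2 h hh).comp hs'.tendsto_atTop⟩

end WeakLimit

/-! ### Existence of minimizers -/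

section Existence

variable {d k n : ℕ} {D : Opens (EuclideanSpace ℝ (Fin d))} {A : Fin n → Finset (Fin k)}
  {Λ : Fin n → ℝ} {g U : EuclideanSpace ℝ (Fin d) → EuclideanSpace ℝ (Fin k)}
  {W : ℕ → EuclideanSpace ℝ (Fin d) → EuclideanSpace ℝ (Fin k)}

/-- A sequence in `H¹₀(D)` with gradients bounded in `L²` has a subsequence converging almost
everywhere, with gradients converging weakly, to an `H¹₀` function. -/
lemma exists_subseq_hasH10Grad [NeZero d]
    (hD : Bornology.IsBounded (D : Set (EuclideanSpace ℝ (Fin d))))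
    {w : ℕ → EuclideanSpace ℝ (Fin d) → ℝ}
    {K : ℕ → EuclideanSpace ℝ (Fin d) → EuclideanSpace ℝ (Fin d)} {M : ℝ≥0∞} (hM : M ≠ ∞)
    (hw : ∀ m, HasH10Grad D (w m) (K m)) (hK : ∀ m, eLpNorm (K m) 2 (volume.restrict D) ≤ M) :
    ∃ (s : ℕ → ℕ) (v : EuclideanSpace ℝ (Fin d) → ℝ)
      (G : EuclideanSpace ℝ (Fin d) → EuclideanSpace ℝ (Fin d)), StrictMono s ∧
      HasH10Grad D v G ∧
      (∀ᵐ x ∂volume.restrict (D : Set (EuclideanSpace ℝ (Fin d))),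
        Tendsto (fun m => w (s m) x) atTop (𝓝 (v x))) ∧
      ∀ h, MemLp h 2 (volume.restrict (D : Set (EuclideanSpace ℝ (Fin d)))) →
        Tendsto (fun m => ∫ x in D, inner ℝ (K (s m) x) (h x)) atTop
          (𝓝 (∫ x in D, inner ℝ (G x) (h x))) := by
  -- replace the functions by test functions at distance at most `1 / (m + 1)`
  have hε : ∀ m : ℕ, (0 : ℝ≥0∞) < ((m : ℝ≥0∞) + 1)⁻¹ := fun m =>
    ENNReal.inv_pos.2 (by finiteness)
  have hlim : Tendsto (fun m : ℕ => ((m : ℝ≥0∞) + 1)⁻¹) atTop (𝓝 0) := by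
    have := (tendsto_add_atTop_iff_nat 1).2 ENNReal.tendsto_inv_nat_nhds_zero
    simpa using this
  choose φ h1 h2 using fun m => (hw m).2 _ (hε m)
  have hdm : ∀ m, MemLp (fun x => K m x - ∇ (φ m) x) 2 (volume.restrict D) := fun m =>
    (hw m).1.memLp_grad.sub ((φ m).memLp_gradient 2 _)
  have hbound : ∀ m, eLpNorm (∇ (φ m)) 2 (volume.restrict D) ≤ M + 1 := by
    intro m
    have e : ∇ (φ m) = K m - fun x => K m x - ∇ (φ m) x := by
      funext x; simp
    rw [e]
    refine (eLpNorm_sub_le (hw m).1.memLp_grad.1 (hdm m).1 one_le_two).trans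
      (add_le_add (hK m) ((h2 m).le.trans ?_))
    simp
  obtain ⟨s, v, G, hs, hv, hae, hweak⟩ := exists_subseq_testFunction hD (by finiteness) hbound
  have hd0 : Tendsto (fun m => eLpNorm (fun x => w (s m) x - φ (s m) x) 2 (volume.restrict D))
      atTop (𝓝 0) :=
    tendsto_of_tendsto_of_tendsto_of_le_of_le tendsto_const_nhds
      (hlim.comp hs.tendsto_atTop) (fun _ => zero_le) fun m => (h1 (s m)).le
  have hmeas : TendstoInMeasure (volume.restrict (D : Set (EuclideanSpace ℝ (Fin d))))
      (fun m x => w (s m) x - φ (s m) x) atTop (fun _ => 0) := by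
    refine tendstoInMeasure_of_tendsto_eLpNorm two_ne_zero
      (fun m => ((hw _).1.memLp.sub ((φ (s m)).memLp 2 _)).1) aestronglyMeasurable_const
      (hd0.congr fun m => ?_)
    congr 1
    funext x
    simp
  obtain ⟨t, ht, hae'⟩ := hmeas.exists_seq_tendsto_ae
  refine ⟨s ∘ t, v, G, hs.comp ht, hv, ?_, fun h hh => ?_⟩
  · filter_upwards [hae, hae'] with x hx hx'
    simpa using hx'.add (hx.comp ht.tendsto_atTop)
  · have h3 := tendsto_integral_inner (l := atTop) (f₀ := fun _ => 0) (fun m => hdm (s (t m)))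
      MemLp.zero' hh (by
        refine tendsto_of_tendsto_of_tendsto_of_le_of_le tendsto_const_nhds
          (hlim.comp (hs.comp ht).tendsto_atTop) (fun _ => zero_le) fun m => ?_
        refine le_trans (le_of_eq ?_) (h2 (s (t m))).le
        rw [← eLpNorm_neg]
        congr 1
        funext x
        simp)
    have h4 := h3.add ((hweak h hh).comp ht.tendsto_atTop)
    simp only [inner_zero_left, integral_zero, zero_add] at h4
    refine h4.congr fun m => ?_
    simp only [Function.comp_apply]
    rw [← integral_add (integrable_inner_of_memLp (hdm _) hh)
      (integrable_inner_of_memLp ((φ _).memLp_gradient 2 _) hh)]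
    refine integral_congr_ae (Eventually.of_forall fun x => ?_)
    simp [inner_sub_left]

/-- The measure of the phases is lower semicontinuous under almost everywhere convergence: the
phase of the limit is exhausted by the sets of points which stay in the phases of the sequence
from some index on. -/
lemma exists_tendsto_measureReal_phase
    [IsFiniteMeasure (volume.restrict (D : Set (EuclideanSpace ℝ (Fin d))))]
    (hlim : ∀ᵐ x ∂volume.restrict (D : Set (EuclideanSpace ℝ (Fin d))),
      ∀ i, Tendsto (fun m => W m x i) atTop (𝓝 (U x i))) (j : Fin n) :
    ∃ p : ℕ → ℝ, Tendsto p atTop (𝓝 (volume.real (phase D A U j))) ∧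
      ∀ N, p N ≤ volume.real (phase D A (W N) j) := by
  have hfin : ∀ V, volume (phase D A V j) ≠ ∞ := fun V => by
    refine ne_top_of_le_ne_top (measure_ne_top
      (volume.restrict (D : Set (EuclideanSpace ℝ (Fin d)))) univ) ?_
    rw [Measure.restrict_apply_univ]
    exact measure_mono fun x hx => hx.1
  let B : ℕ → Set (EuclideanSpace ℝ (Fin d)) :=
    fun N => {x | x ∈ phase D A U j ∧ ∀ m, N ≤ m → x ∈ phase D A (W m) j}
  have hB : Monotone B := fun N N' h x hx => ⟨hx.1, fun m hm => hx.2 m (h.trans hm)⟩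
  have hunion : volume (⋃ N, B N) = volume (phase D A U j) := by
    refine measure_congr ?_
    rw [ae_restrict_iff' D.isOpen.measurableSet] at hlim
    filter_upwards [hlim] with x hx
    refine propext ⟨fun h => ?_, fun h => ?_⟩
    · obtain ⟨N, hN⟩ := mem_iUnion.1 h
      exact hN.1
    · obtain ⟨hxD, i, hi, hne⟩ := h
      obtain ⟨N, hN⟩ := eventually_atTop.1 ((hx hxD i).eventually_ne hne)
      exact mem_iUnion.2 ⟨N, ⟨hxD, i, hi, hne⟩, fun m hm => ⟨hxD, i, hi, hN m hm⟩⟩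
  refine ⟨fun N => volume.real (B N), ?_, fun N => ?_⟩
  · have := tendsto_measure_iUnion_atTop (μ := volume) hB
    rw [hunion] at this
    exact (ENNReal.tendsto_toReal (hfin U)).comp this
  · exact measureReal_mono (fun x hx => hx.2 N le_rfl) (hfin _)

/-- The energy is lower semicontinuous. For the Dirichlet integral this is
`‖∇W‖² ≥ 2 ⟨∇W, ∇U⟩ - ‖∇U‖²`, whose right-hand side is weakly continuous in `W`. -/
lemma energy_le_of_tendsto
    [IsFiniteMeasure (volume.restrict (D : Set (EuclideanSpace ℝ (Fin d))))]
    (hΛ : ∀ j, 0 < Λ j)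
    {H : ℕ → Fin k → EuclideanSpace ℝ (Fin d) → EuclideanSpace ℝ (Fin d)}
    {G : Fin k → EuclideanSpace ℝ (Fin d) → EuclideanSpace ℝ (Fin d)}
    (hW : ∀ m i, HasH1Grad D (fun x => W m x i) (H m i))
    (hU : ∀ i, HasH1Grad D (fun x => U x i) (G i))
    (hlim : ∀ᵐ x ∂volume.restrict (D : Set (EuclideanSpace ℝ (Fin d))),
      ∀ i, Tendsto (fun m => W m x i) atTop (𝓝 (U x i)))
    (hweak : ∀ i, Tendsto (fun m => ∫ x in D, inner ℝ (H m i x) (G i x)) atTop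
      (𝓝 (∫ x in D, inner ℝ (G i x) (G i x))))
    {e : ℕ → ℝ} {a : ℝ} (he : Tendsto e atTop (𝓝 a)) (hle : ∀ m, energy D A Λ (W m) ≤ e m) :
    energy D A Λ U ≤ a := by
  choose p hp hple using fun j => exists_tendsto_measureReal_phase (A := A) hlim j
  have h1 : Tendsto (fun m => (∑ i, (2 * (∫ x in D, inner ℝ (H m i x) (G i x)) -
      ∫ x in D, ‖G i x‖ ^ 2)) + ∑ j, Λ j * p j m) atTop (𝓝 (energy D A Λ U)) := by
    rw [energy_eq hU]
    refine (tendsto_finsetSum _ fun i _ => ?_).add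
      (tendsto_finsetSum _ fun j _ => (hp j).const_mul _)
    have h := ((hweak i).const_mul 2).sub_const (∫ x in D, ‖G i x‖ ^ 2)
    simp only [real_inner_self_eq_norm_sq] at h
    convert h using 2
    ring
  refine le_of_tendsto_of_tendsto' h1 he fun m => le_trans ?_ (hle m)
  rw [energy_eq (hW m)]
  refine add_le_add (Finset.sum_le_sum fun i _ => ?_)
    (Finset.sum_le_sum fun j _ => mul_le_mul_of_nonneg_left (hple j m) (hΛ j).le)
  have hi := integrable_inner_of_memLp (hW m i).memLp_grad (hU i).memLp_grad
  have hG : Integrable (fun x => ‖G i x‖ ^ 2) (volume.restrict D) :=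
    (hU i).memLp_grad.integrable_norm_pow two_ne_zero
  rw [← integral_const_mul, ← integral_sub (hi.const_mul 2) hG]
  refine integral_mono ((hi.const_mul 2).sub hG)
    ((hW m i).memLp_grad.integrable_norm_pow two_ne_zero) fun x => ?_
  have := norm_sub_sq_real (H m i x) (G i x)
  have := sq_nonneg ‖H m i x - G i x‖
  simp only
  linarith

lemma energy_nonneg (hΛ : ∀ j, 0 < Λ j)
    (W : EuclideanSpace ℝ (Fin d) → EuclideanSpace ℝ (Fin k)) : 0 ≤ energy D A Λ W :=
  add_nonneg (integral_nonneg fun _ => Finset.sum_nonneg fun _ _ => by positivity)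
    (Finset.sum_nonneg fun j _ => mul_nonneg (hΛ j).le measureReal_nonneg)

lemma isAdmissible_self (hg : MemH1Sigma D A g) : IsAdmissible D A g g := by
  refine ⟨hg, fun i => ?_⟩
  have h := (0 : TestFunction D ℝ ⊤).hasH10Grad.memH10
  simp only [sub_self]
  exact h

/-- The direct method: a minimizing sequence converges to a minimizer along a subsequence. -/
lemma exists_isMinimizer [NeZero d]
    (hD : Bornology.IsBounded (D : Set (EuclideanSpace ℝ (Fin d)))) (hΛ : ∀ j, 0 < Λ j)
    (hg : MemH1Sigma D A g) : ∃ U, IsMinimizer D A Λ g U := by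
  have : IsFiniteMeasure (volume.restrict (D : Set (EuclideanSpace ℝ (Fin d)))) :=
    ⟨by rw [Measure.restrict_apply_univ]; exact hD.measure_lt_top⟩
  let S : Set ℝ := energy D A Λ '' {W | IsAdmissible D A g W}
  have hSbdd : BddBelow S := ⟨0, by rintro _ ⟨W, -, rfl⟩; exact energy_nonneg hΛ W⟩
  have hSne : S.Nonempty := ⟨_, g, isAdmissible_self hg, rfl⟩
  have hmin : ∀ m : ℕ, ∃ W, IsAdmissible D A g W ∧ energy D A Λ W ≤ sInf S + 1 / ((m : ℝ) + 1) := by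
    intro m
    obtain ⟨_, ⟨W, hW, rfl⟩, hlt⟩ := exists_lt_of_csInf_lt hSne
      (lt_add_of_pos_right (sInf S) (Nat.one_div_pos_of_nat (α := ℝ) (n := m)))
    exact ⟨W, hW, hlt.le⟩
  choose W hW hWe using hmin
  have hWe1 : ∀ m, energy D A Λ (W m) ≤ sInf S + 1 := fun m => (hWe m).trans (by
    gcongr
    rw [div_le_one (by positivity)]
    linarith [(Nat.cast_nonneg m : (0 : ℝ) ≤ m)])
  set Gg : Fin k → EuclideanSpace ℝ (Fin d) → EuclideanSpace ℝ (Fin d) :=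
    fun i => weakGradient D fun x => g x i with hGg
  set H : ℕ → Fin k → EuclideanSpace ℝ (Fin d) → EuclideanSpace ℝ (Fin d) :=
    fun m i => weakGradient D fun x => W m x i with hH
  have hgG : ∀ i, HasH1Grad D (fun x => g x i) (Gg i) := fun i => (hg.1 i).hasH1Grad
  have hWH : ∀ m i, HasH1Grad D (fun x => W m x i) (H m i) := fun m i =>
    ((hW m).1.1 i).hasH1Grad
  have hK : ∀ m i, HasH10Grad D (fun x => W m x i - g x i) (fun x => H m i x - Gg i x) :=
    fun m i => ((hW m).2 i).hasH10Grad.congr (EventuallyEq.refl _ _)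
      ((hWH m i).sub (hgG i)).weakGradient_ae_eq
  have hHbound : ∀ m i, eLpNorm (H m i) 2 (volume.restrict D) ≤
      ENNReal.ofReal √(sInf S + 1) := by
    intro m i
    have h1 := hWe1 m
    rw [energy_eq (hWH m)] at h1
    have h2 : ∫ x in D, ‖H m i x‖ ^ 2 ≤ ∑ i, ∫ x in D, ‖H m i x‖ ^ 2 :=
      Finset.single_le_sum (f := fun i => ∫ x in D, ‖H m i x‖ ^ 2)
        (fun i _ => integral_nonneg fun x => by positivity) (Finset.mem_univ i)
    have h3 : 0 ≤ ∑ j, Λ j * volume.real (phase D A (W m) j) :=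
      Finset.sum_nonneg fun j _ => mul_nonneg (hΛ j).le measureReal_nonneg
    rw [integral_norm_sq_eq (hWH m i).memLp_grad] at h2
    rw [ENNReal.le_ofReal_iff_toReal_le (hWH m i).memLp_grad.eLpNorm_ne_top (Real.sqrt_nonneg _)]
    exact Real.le_sqrt_of_sq_le (by linarith)
  obtain ⟨s, hs, hP⟩ := exists_strictMono_forall
    (P := fun i s => ∃ (v : EuclideanSpace ℝ (Fin d) → ℝ)
      (G : EuclideanSpace ℝ (Fin d) → EuclideanSpace ℝ (Fin d)), HasH10Grad D v G ∧
      (∀ᵐ x ∂volume.restrict (D : Set (EuclideanSpace ℝ (Fin d))),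
        Tendsto (fun m => W (s m) x i - g x i) atTop (𝓝 (v x))) ∧
      ∀ h, MemLp h 2 (volume.restrict (D : Set (EuclideanSpace ℝ (Fin d)))) →
        Tendsto (fun m => ∫ x in (D : Set (EuclideanSpace ℝ (Fin d))),
          inner ℝ (H (s m) i x - Gg i x) (h x)) atTop
          (𝓝 (∫ x in (D : Set (EuclideanSpace ℝ (Fin d))), inner ℝ (G x) (h x))))
    (fun i s t ht ⟨v, G, hv, hae, hw⟩ => ⟨v, G, hv, by
      filter_upwards [hae] with x hx using hx.comp ht.tendsto_atTop,
      fun h hh => (hw h hh).comp ht.tendsto_atTop⟩)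
    (fun i s _ => by
      obtain ⟨t, v, G, ht, hv, hae, hw⟩ := exists_subseq_hasH10Grad hD
        (M := ENNReal.ofReal √(sInf S + 1) + eLpNorm (Gg i) 2 (volume.restrict D))
        (ENNReal.add_ne_top.2 ⟨ENNReal.ofReal_ne_top, (hgG i).memLp_grad.eLpNorm_ne_top⟩)
        (fun m => hK (s m) i) (fun m =>
          (eLpNorm_sub_le (hWH _ i).memLp_grad.1 (hgG i).memLp_grad.1 one_le_two).trans
            (add_le_add (hHbound _ i) le_rfl))
      exact ⟨t, ht, v, G, hv, hae, hw⟩)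
  choose v G hv hae hweak using hP
  let U : EuclideanSpace ℝ (Fin d) → EuclideanSpace ℝ (Fin k) :=
    fun x => WithLp.toLp 2 fun i => g x i + v i x
  have hU : ∀ i, HasH1Grad D (fun x => U x i) (fun x => Gg i x + G i x) :=
    fun i => (hgG i).add (hv i).1
  have hlim : ∀ᵐ x ∂volume.restrict (D : Set (EuclideanSpace ℝ (Fin d))),
      ∀ i, Tendsto (fun m => W (s m) x i) atTop (𝓝 (U x i)) := by
    filter_upwards [ae_all_iff.2 hae] with x hx i
    refine ((hx i).const_add (g x i)).congr fun m => ?_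
    ring
  have hadm : IsAdmissible D A g U := by
    refine ⟨⟨fun i => (hU i).memH1, ?_⟩, fun i => ?_⟩
    · filter_upwards [hlim, ae_all_iff.2 fun m => (hW (s m)).1.2] with x hx hx0
        j j' hjj i hi i' hi'
      refine tendsto_nhds_unique ((hx i).mul (hx i')) (tendsto_const_nhds.congr fun m => ?_)
      exact (hx0 m j j' hjj i hi i' hi').symm
    · refine ((hv i).congr (Eventually.of_forall fun x => ?_) (EventuallyEq.refl _ _)).memH10
      simp [U]
  refine ⟨U, hadm, fun V hV => le_trans ?_ (csInf_le hSbdd ⟨V, hV, rfl⟩)⟩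
  refine energy_le_of_tendsto hΛ (fun m i => hWH (s m) i) hU hlim (fun i => ?_)
    (e := fun m => sInf S + 1 / ((s m : ℝ) + 1)) ?_ fun m => hWe (s m)
  · have hh := (hU i).memLp_grad
    have h1 := (hweak i _ hh).const_add (∫ x in D, inner ℝ (Gg i x) (Gg i x + G i x))
    rw [← integral_add (integrable_inner_of_memLp (hgG i).memLp_grad hh)
      (integrable_inner_of_memLp (hv i).1.memLp_grad hh)] at h1
    simp only [← inner_add_left] at h1
    refine h1.congr fun m => ?_
    rw [← integral_add (integrable_inner_of_memLp (hgG i).memLp_grad hh)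
      (integrable_inner_of_memLp (hK (s m) i).1.memLp_grad hh)]
    simp only [← inner_add_left, add_sub_cancel]
  · simpa using (tendsto_one_div_add_atTop_nhds_zero_nat.comp hs.tendsto_atTop).const_add (sInf S)

/-- The space `ℝ⁰` is a point, where the Poincaré inequality fails. Every function on `D` is a test
function then, so the zero function is a competitor, and its energy is `0`. -/
lemma exists_isMinimizer_of_eq_zero (hd : d = 0) (hΛ : ∀ j, 0 < Λ j)
    (hg : MemH1Sigma D A g) : ∃ U, IsMinimizer D A Λ g U := by
  subst hd
  have hz : MemH10 D fun _ => 0 := (0 : TestFunction D ℝ ⊤).hasH10Grad.memH10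
  have h10 : ∀ i, MemH10 D fun x => 0 - g x i := by
    intro i
    rcases (D : Set (EuclideanSpace ℝ (Fin 0))).eq_empty_or_nonempty with hD | ⟨y, hy⟩
    · refine ((0 : TestFunction D ℝ ⊤).hasH10Grad.congr ?_ (EventuallyEq.refl _ _)).memH10
      rw [hD, Measure.restrict_empty]
      exact ae_zero.le trivial
    · let φ : TestFunction D ℝ ⊤ := ⟨fun _ => 0 - g y i, contDiff_const,
        (Set.toFinite _).isCompact, fun x _ => (Subsingleton.elim x y) ▸ hy⟩
      have e : (fun x => 0 - g x i) = φ := funext fun x => by rw [Subsingleton.elim x y]; rfl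
      rw [e]
      exact φ.hasH10Grad.memH10
  refine ⟨fun _ => 0, ⟨⟨fun i => hz.1, by simp⟩, h10⟩, fun W _ => ?_⟩
  refine le_trans (le_of_eq ?_) (energy_nonneg hΛ W)
  have hw : ∀ (u : EuclideanSpace ℝ (Fin 0) → ℝ) x, weakGradient D u x = 0 :=
    fun u x => Subsingleton.elim _ _
  simp [energy, phase, hw]

end Existence

/-! ### Subharmonicity of the norms of a minimizer -/

section MinimizerNorm

variable {d k n : ℕ} {D : Opens (EuclideanSpace ℝ (Fin d))} {A : Fin n → Finset (Fin k)}
  {Λ : Fin n → ℝ} {g U : EuclideanSpace ℝ (Fin d) → EuclideanSpace ℝ (Fin k)}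

lemma norm_group (A : Fin n → Finset (Fin k))
    (U : EuclideanSpace ℝ (Fin d) → EuclideanSpace ℝ (Fin k)) (j : Fin n)
    (x : EuclideanSpace ℝ (Fin d)) : ‖group A U j x‖ = √(∑ l ∈ A j, U x l ^ 2) := by
  simp [EuclideanSpace.norm_eq, group, ite_pow, Finset.sum_ite_mem]

/-- At a point where at most one group does not vanish, the norm of `U` is the sum of the norms of
its groups. -/
lemma norm_eq_sum_norm_group (hA : ∀ i, ∃! j, i ∈ A j) {x : EuclideanSpace ℝ (Fin d)}
    (hx : ∀ j j', j ≠ j' → ∀ i ∈ A j, ∀ i' ∈ A j', U x i * U x i' = 0) :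
    ‖U x‖ = ∑ j, ‖group A U j x‖ := by
  by_cases h : ∃ i, U x i ≠ 0
  · obtain ⟨i, hi⟩ := h
    obtain ⟨j, hj, -⟩ := hA i
    have h0 : ∀ j', j' ≠ j → ∀ l ∈ A j', U x l = 0 := fun j' hj' l hl =>
      (mul_eq_zero.1 (hx j' j hj' l hl i hj)).resolve_right hi
    rw [Finset.sum_eq_single j]
    · congr 1
      ext l
      obtain ⟨j', hj', huniq⟩ := hA l
      by_cases hl : l ∈ A j
      · simp [group, hl]
      · have : j' ≠ j := fun e => hl (e ▸ hj')
        simp [group, hl, h0 j' this l hj']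
    · intro j' _ hj'
      rw [norm_group, Finset.sum_eq_zero fun l hl => by rw [h0 j' hj' l hl]; ring, Real.sqrt_zero]
    · simp
  · push Not at h
    have : U x = 0 := by ext i; exact h i
    simp [norm_group, this]

lemma IsMinimizer.isDistribSubharmonic_group
    [IsFiniteMeasure (volume.restrict (D : Set (EuclideanSpace ℝ (Fin d))))]
    (hA : ∀ i, ∃! j, i ∈ A j) (hΛ : ∀ j, 0 < Λ j) (hU : IsMinimizer D A Λ g U) (j : Fin n) :
    MemLp (fun x => ‖group A U j x‖) 2 (volume.restrict D) ∧
      IsDistribSubharmonic D fun x => ‖group A U j x‖ := by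
  simp only [norm_group]
  exact isDistribSubharmonic_sqrt (u := fun l x => U x l) hU.1.1.1
    fun i hi => hU.isHarmonicOn hA hΛ hi

lemma IsMinimizer.isDistribSubharmonic_norm
    [IsFiniteMeasure (volume.restrict (D : Set (EuclideanSpace ℝ (Fin d))))]
    (hA : ∀ i, ∃! j, i ∈ A j) (hΛ : ∀ j, 0 < Λ j) (hU : IsMinimizer D A Λ g U) :
    IsDistribSubharmonic D fun x => ‖U x‖ := by
  have hgrp := fun j => hU.isDistribSubharmonic_group hA hΛ j
  have hae : (fun x => ∑ j, ‖group A U j x‖) =ᵐ[volume.restrict D] fun x => ‖U x‖ := by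
    filter_upwards [hU.1.1.2] with x hx
    exact (norm_eq_sum_norm_group hA hx).symm
  have hm : MemLp (fun x => ‖U x‖) 2 (volume.restrict D) :=
    (memLp_finsetSum _ fun j _ => (hgrp j).1).ae_eq hae
  refine ⟨locallyIntegrableOn_of_locallyIntegrable_restrict (hm.locallyIntegrable one_le_two),
    fun φ hφ => ?_⟩
  have e : ∫ x in D, ‖U x‖ * Δ (φ : EuclideanSpace ℝ (Fin d) → ℝ) x =
      ∑ j, ∫ x in D, ‖group A U j x‖ * Δ (φ : EuclideanSpace ℝ (Fin d) → ℝ) x := by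
    rw [← integral_finsetSum _ fun j _ => integrable_mul_of_memLp (hgrp j).1 (memLp_laplacian φ)]
    refine integral_congr_ae ?_
    filter_upwards [hae] with x hx
    rw [← hx, Finset.sum_mul]
  rw [e]
  exact Finset.sum_nonneg fun j _ => (hgrp j).2.2 φ hφ

end MinimizerNorm

end MultiphaseBernoulli

theorem proposition2p1 {d k n : ℕ}
    (D : TopologicalSpace.Opens (EuclideanSpace ℝ (Fin d)))
    (hD : Bornology.IsBounded (D : Set (EuclideanSpace ℝ (Fin d))))
    (A : Fin n → Finset (Fin k)) (hA : ∀ i, ∃! j, i ∈ A j)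
    (Λ : Fin n → ℝ) (hΛ : ∀ j, 0 < Λ j)
    (g : EuclideanSpace ℝ (Fin d) → EuclideanSpace ℝ (Fin k))
    (hg : MultiphaseBernoulli.MemH1Sigma D A g) :
    (∃ U, MultiphaseBernoulli.IsMinimizer D A Λ g U) ∧
    ∀ U, MultiphaseBernoulli.IsMinimizer D A Λ g U →
      (∀ j, ∀ i ∈ A j, MultiphaseBernoulli.IsHarmonicOn D
        (MultiphaseBernoulli.phase D A U j) (fun x => U x i)) ∧
      MultiphaseBernoulli.IsDistribSubharmonic D (fun x => ‖U x‖) ∧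
      ∀ j, MultiphaseBernoulli.IsDistribSubharmonic D
        (fun x => ‖MultiphaseBernoulli.group A U j x‖) := by
  have : IsFiniteMeasure (volume.restrict (D : Set (EuclideanSpace ℝ (Fin d)))) :=
    ⟨by rw [Measure.restrict_apply_univ]; exact hD.measure_lt_top⟩
  refine ⟨?_, fun U hU => ⟨fun j i hi => hU.isHarmonicOn hA hΛ hi,
    hU.isDistribSubharmonic_norm hA hΛ, fun j => (hU.isDistribSubharmonic_group hA hΛ j).2⟩⟩
  rcases eq_or_ne d 0 with hd | hd
  · exact MultiphaseBernoulli.exists_isMinimizer_of_eq_zero hd hΛ hg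
  · have : NeZero d := ⟨hd⟩
    exact MultiphaseBernoulli.exists_isMinimizer hD hΛ hg
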